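/- **Definitions.** Let $\Omega=(a,b)$ with $-\infty<a<b<\infty$, or $\Omega=\mathbb R$. For $\sigma>0$ put $${}^{-}I^{\sigma}f(x)=\frac1{\Gamma(\sigma)}\int_{\Omega\cap(-\infty,x)}\frac{f(y)}{(x-y)^{1-\sigma}}\,dy,\qquad {}^{+}I^{\sigma}f(x)=\frac1{\Gamma(\sigma)}\int_{\Omega\cap(x,\infty)}\frac{f(y)}{(y-x)^{1-\sigma}}\,dy,$$ the left ($-$) and right ($+$) fractional integrals on $\Omega$, and on $(a,b)$ let $\kappa^{\sigma}_{-}(x)=(x-a)^{\sigma-1}$, $\kappa^{\sigma}_{+}(x)=(b-x)^{\sigma-1}$. For $0<\sigma<1$ and $\varphi\in C_0^\infty(\Omega)$, extended by zero to $\tilde\varphi$ on $\mathbb R$, let ${}^{-}D^{\sigma}\tilde\varphi=\frac{d}{dx}\,{}^{-}I^{1-\sigma}\tilde\varphi$ and ${}^{+}D^{\sigma}\tilde\varphi=-\frac{d}{dx}\,{}^{+}I^{1-\sigma}\tilde\varphi$, with fractional integrals over $\mathbb R$. A function $v\in L^1_{loc}(\Omega)$ is the weak fractional derivative ${}^{\pm}\mathcal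 D^{\sigma}u$ of $u\in L^1(\Omega)$ if $$\int_\Omega v\,\varphi\,dx=\int_\Omega u\;{}^{\mp}D^{\sigma}\tilde\varphi\,dx\qquad\text{for all }\varphi\in C_0^\infty(\Omega).$$ **Proposition.** Let $0<\alpha<\beta<1$. 1. (Finite interval.) Let $\Omega=(a,b)$, let $u\in L^1(\Omega)$, and suppose that ${}^{\pm}\mathcal D^{\beta}u$ exists in $L^1(\Omega)$. Then ${}^{\pm}\mathcal D^{\alpha}u$ exists in $L^1(\Omega)$, and $${}^{\pm}\mathcal D^{\alpha}u=c_{\pm}\,\kappa^{\beta-\alpha}_{\pm}+{}^{\pm}I^{\beta-\alpha}\;{}^{\pm}\mathcal D^{\beta}u\quad\text{a.e. in }\Omega,$$ where $$c_-=\frac{1}{\Gamma(\beta-\alpha)}\lim_{x\to a^+}{}^{-}I^{1-\beta}u(x),\qquad c_+=\frac{1}{\Gamma(\beta-\alpha)}\lim_{x\to b^-}{}^{+}I^{1-\beta}u(x),$$ and the limit in the sign case considered exists and is finite. 2. (Real line.) If $u\in L^1(\mathbb R)$ and ${}^{\pm}\mathcal D^{\beta}u$ exists in $L^1(\mathbb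 R)$, then ${}^{\pm}\mathcal D^{\alpha}u$ exists in $L^1(\mathbb R)$. In each part, the left ($-$) and right ($+$) versions hold separately. -/

import Mathlib

open MeasureTheory Set Filter Topology
open scoped ContDiff

noncomputable section

/-- Left fractional integral of order `σ > 0` over the open interval `Ω` (Riemann-Liouville for
`Ω = (a, b)`, Liouville for `Ω = ℝ`):
`(1 / Γ(σ)) ∫_{y ∈ Ω, y < x} f(y) / (x - y)^(1 - σ) dy`. -/
def leftFracInt (Ω : Set ℝ) (σ : ℝ) (f : ℝ → ℝ) (x : ℝ) : ℝ :=
  1 / Real.Gamma σ * ∫ y in Ω ∩ Iio x, f y / (x - y) ^ (1 - σ)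

/-- Right fractional integral of order `σ > 0` over the open interval `Ω`:
`(1 / Γ(σ)) ∫_{y ∈ Ω, x < y} f(y) / (y - x)^(1 - σ) dy`. -/
def rightFracInt (Ω : Set ℝ) (σ : ℝ) (f : ℝ → ℝ) (x : ℝ) : ℝ :=
  1 / Real.Gamma σ * ∫ y in Ω ∩ Ioi x, f y / (y - x) ^ (1 - σ)

/-- Classical left Liouville fractional derivative on `ℝ` of order `α ∈ (0, 1)`. -/
def leftFracDeriv (α : ℝ) (f : ℝ → ℝ) (x : ℝ) : ℝ :=
  deriv (leftFracInt univ (1 - α) f) x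

/-- Classical right Liouville fractional derivative on `ℝ` of order `α ∈ (0, 1)`. -/
def rightFracDeriv (α : ℝ) (f : ℝ → ℝ) (x : ℝ) : ℝ :=
  - deriv (rightFracInt univ (1 - α) f) x

/-- (Zero extensions to `ℝ` of) smooth functions with compact support contained in `Ω`. -/
structure IsTestFunction (Ω : Set ℝ) (φ : ℝ → ℝ) : Prop where
  smooth : ContDiff ℝ ∞ φ
  compact : HasCompactSupport φ
  support : tsupport φ ⊆ Ω

/-- `v` is the left weak fractional derivative of order `α ∈ (0, 1)` of `u ∈ L¹(Ω)` on the open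
interval `Ω`. Only the values of `u` and `v` in `Ω` matter. -/
structure IsLeftWeakFracDeriv (Ω : Set ℝ) (α : ℝ) (u v : ℝ → ℝ) : Prop where
  integrableOn : IntegrableOn u Ω
  locallyIntegrableOn : LocallyIntegrableOn v Ω
  integral_eq : ∀ φ : ℝ → ℝ, IsTestFunction Ω φ →
    ∫ x in Ω, v x * φ x = ∫ x in Ω, u x * rightFracDeriv α φ x

/-- `v` is the right weak fractional derivative of order `α ∈ (0, 1)` of `u ∈ L¹(Ω)` on the open
interval `Ω`. Only the values of `u` and `v` in `Ω` matter. -/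
structure IsRightWeakFracDeriv (Ω : Set ℝ) (α : ℝ) (u v : ℝ → ℝ) : Prop where
  integrableOn : IntegrableOn u Ω
  locallyIntegrableOn : LocallyIntegrableOn v Ω
  integral_eq : ∀ φ : ℝ → ℝ, IsTestFunction Ω φ →
    ∫ x in Ω, v x * φ x = ∫ x in Ω, u x * leftFracDeriv α φ x

/-- The kernel function `κ₋^σ(x) = (x - a)^(σ - 1)` of the interval `(a, b)`. -/
def leftKernel (a σ x : ℝ) : ℝ := (x - a) ^ (σ - 1)

/-- The kernel function `κ₊^σ(x) = (b - x)^(σ - 1)` of the interval `(a, b)`. -/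
def rightKernel (b σ x : ℝ) : ℝ := (b - x) ^ (σ - 1)

end

/-! Extending by zero turns the left integrals into convolutions with the kernels `fracKernel σ`, a
semigroup under convolution by Euler's beta integral (`fracConv_fracConv`). Moving the right
derivative off the test function (`setIntegral_mul_rightFracDeriv`) shows that I^(1-β)u - I^1 v
annihilates all φ', so du Bois-Reymond gives I^(1-β)u = C + I^1 v a.e. in Ω
(`IsLeftWeakFracDeriv.exists_fracConv_eq`).

On (a, b), the constant C is C times the kernel of order 1 based at a. Applying I^(β-α) gives
I^(1-α)u = I^1 W with W = C(x-a)^(β-α-1)/Γ(β-α) + I^(β-α)v (`fracConv_eq_fracConv_one`). Since W is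
integrable on (a, b), pairing with φ' identifies it as the weak derivative of order α. The same
computation at α = 0 represents u itself, which upgrades the a.e. identity to an everywhere one
(`fracConv_eq_of_ae`) and gives the limit C at a.

On the line, I^(β-α)v need not be integrable, so the derivative is built in Marchaud form. The
difference u - u(· - t) is the convolution of v with a difference of kernels, whose L¹ norm scales
like t^β (`integral_norm_sub_le`). Hence t^(-1-α)(u(x) - u(x-t)) is integrable in (x, t), because α
< β, and Fubini transfers it to the Marchaud form of the right derivative of φ
(`IsTestFunction.integral_marchaud`). The right-sided statements follow by reflection x ↦ -x. -/

/-! ### The power kernels and their convolution semigroup -/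

/-- The causal power kernel `t₊^(σ - 1) / Γ(σ)`. -/
noncomputable def fracKernel (σ t : ℝ) : ℝ := if 0 < t then t ^ (σ - 1) / Real.Gamma σ else 0

/-- Left Liouville fractional integral on the line, as a convolution with `fracKernel`. -/
noncomputable def fracConv (σ : ℝ) (f : ℝ → ℝ) (x : ℝ) : ℝ := ∫ y, fracKernel σ (x - y) * f y

/-- Right Liouville fractional integral on the line, the adjoint of `fracConv`. -/
noncomputable def fracCoconv (σ : ℝ) (f : ℝ → ℝ) (y : ℝ) : ℝ := ∫ x, fracKernel σ (x - y) * f x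

lemma fracKernel_of_nonpos {σ t : ℝ} (ht : t ≤ 0) : fracKernel σ t = 0 := if_neg ht.not_gt

lemma fracKernel_of_pos {σ t : ℝ} (ht : 0 < t) :
    fracKernel σ t = t ^ (σ - 1) / Real.Gamma σ := if_pos ht

lemma fracKernel_nonneg {σ : ℝ} (hσ : 0 < σ) (t : ℝ) : 0 ≤ fracKernel σ t := by
  unfold fracKernel
  split_ifs with h
  · exact div_nonneg (Real.rpow_nonneg h.le _) (Real.Gamma_pos_of_pos hσ).le
  · exact le_rfl

lemma fracKernel_one (t : ℝ) : fracKernel 1 t = if 0 < t then 1 else 0 := by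
  simp [fracKernel]

lemma measurable_fracKernel (σ : ℝ) : Measurable (fracKernel σ) :=
  Measurable.ite measurableSet_Ioi ((measurable_id.pow_const _).div_const _) measurable_const

lemma fracKernel_mul {σ h : ℝ} (hh : 0 < h) (t : ℝ) :
    fracKernel σ (h * t) = h ^ (σ - 1) * fracKernel σ t := by
  by_cases ht : 0 < t
  · rw [fracKernel_of_pos ht, fracKernel_of_pos (mul_pos hh ht), Real.mul_rpow hh.le ht.le]
    ring
  · rw [fracKernel_of_nonpos (not_lt.1 ht),
      fracKernel_of_nonpos (mul_nonpos_of_nonneg_of_nonpos hh.le (not_lt.1 ht)), mul_zero]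

/-- Up to the factor 1/Γ(σ+τ), the product is the density of the Beta(τ, σ) distribution, which has
total mass 1. -/
lemma integral_fracKernel_mul_one_sub {σ τ : ℝ} (hσ : 0 < σ) (hτ : 0 < τ) :
    Integrable (fun p => fracKernel σ (1 - p) * fracKernel τ p) ∧
      ∫ p, fracKernel σ (1 - p) * fracKernel τ p = 1 / Real.Gamma (σ + τ) := by
  have hG := Real.Gamma_pos_of_pos hσ
  have hG' := Real.Gamma_pos_of_pos hτ
  have hG'' := Real.Gamma_pos_of_pos (add_pos hσ hτ)
  have e : (fun p => fracKernel σ (1 - p) * fracKernel τ p) =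
      fun p => (1 / Real.Gamma (σ + τ)) * ProbabilityTheory.betaPDFReal τ σ p := by
    funext p
    unfold fracKernel ProbabilityTheory.betaPDFReal ProbabilityTheory.beta
    by_cases h0 : 0 < p <;> by_cases h1 : p < 1 <;> simp [h0, h1]
    rw [add_comm τ σ]
    field_simp
  have hm : Measurable (ProbabilityTheory.betaPDFReal τ σ) :=
    ProbabilityTheory.measurable_betaPDFReal τ σ
  have hn : ∀ x, 0 ≤ ProbabilityTheory.betaPDFReal τ σ x := by
    intro x
    unfold ProbabilityTheory.betaPDFReal
    split_ifs with h
    · have := ProbabilityTheory.beta_pos hτ hσ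
      have := Real.rpow_nonneg h.1.le (τ - 1)
      have := Real.rpow_nonneg (sub_nonneg.2 h.2.le) (σ - 1)
      positivity
    · exact le_rfl
  have hl : ∫⁻ x, ENNReal.ofReal (ProbabilityTheory.betaPDFReal τ σ x) = 1 :=
    ProbabilityTheory.lintegral_betaPDF_eq_one hτ hσ
  have hi : Integrable (ProbabilityTheory.betaPDFReal τ σ) := by
    refine ⟨hm.aestronglyMeasurable, ?_⟩
    rw [hasFiniteIntegral_iff_ofReal (Eventually.of_forall hn), hl]
    simp
  rw [e]
  refine ⟨hi.const_mul _, ?_⟩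
  rw [integral_const_mul, integral_eq_lintegral_of_nonneg_ae (Eventually.of_forall hn)
    hm.aestronglyMeasurable, hl]
  simp

/-- The kernels form a convolution semigroup (Euler's beta integral). -/
lemma integral_fracKernel_mul {σ τ : ℝ} (hσ : 0 < σ) (hτ : 0 < τ) (x y : ℝ) :
    Integrable (fun s => fracKernel σ (x - s) * fracKernel τ (s - y)) ∧
      ∫ s, fracKernel σ (x - s) * fracKernel τ (s - y) = fracKernel (σ + τ) (x - y) := by
  rcases le_or_gt (x - y) 0 with h | h
  · have e : (fun s => fracKernel σ (x - s) * fracKernel τ (s - y)) = fun _ => 0 := by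
      funext s
      rcases le_or_gt (x - s) 0 with h1 | h1
      · rw [fracKernel_of_nonpos h1, zero_mul]
      · rw [fracKernel_of_nonpos (by linarith : s - y ≤ 0), mul_zero]
    rw [e, fracKernel_of_nonpos h]
    simp
  · obtain ⟨h1, h2⟩ := integral_fracKernel_mul_one_sub hσ hτ
    set g : ℝ → ℝ := fun p => fracKernel σ (1 - p) * fracKernel τ p
    -- The substitution s = y + (x - y)p and homogeneity of the kernels reduce the integral to the
    -- unit interval.
    have e : (fun s => fracKernel σ (x - s) * fracKernel τ (s - y)) =
        fun s => ((x - y) ^ (σ - 1) * (x - y) ^ (τ - 1)) * g ((s - y) / (x - y)) := by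
      funext s
      have e1 : x - s = (x - y) * (1 - (s - y) / (x - y)) := by field_simp; ring
      have e2 : s - y = (x - y) * ((s - y) / (x - y)) := by field_simp
      conv_lhs => rw [e1, e2]
      rw [fracKernel_mul h, fracKernel_mul h]
      have e3 : (x - y) * ((s - y) / (x - y)) / (x - y) = (s - y) / (x - y) := by field_simp
      rw [e3]
      simp only [g]
      ring
    rw [e]
    constructor
    · exact (((h1.comp_div h.ne').comp_sub_right y)).const_mul _
    · rw [integral_const_mul, integral_sub_right_eq_self (fun s => g (s / (x - y))) y,
        Measure.integral_comp_div, h2, abs_of_pos h, fracKernel_of_pos h, smul_eq_mul,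
        ← Real.rpow_add h, show σ + τ - 1 = (σ - 1 + (τ - 1)) + 1 by ring, Real.rpow_add_one h.ne']
      ring

/-- Semigroup property of the fractional integrals. -/
lemma fracConv_fracConv {σ τ x : ℝ} (hσ : 0 < σ) (hτ : 0 < τ) {f : ℝ → ℝ}
    (hf : AEStronglyMeasurable f) (hx : Integrable fun y => fracKernel (σ + τ) (x - y) * f y) :
    Integrable (fun s => fracKernel σ (x - s) * fracConv τ f s) ∧
      fracConv σ (fracConv τ f) x = fracConv (σ + τ) f x := by
  have hm : AEStronglyMeasurable
      (fun z : ℝ × ℝ => fracKernel σ (x - z.1) * (fracKernel τ (z.1 - z.2) * f z.2))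
      (volume.prod volume) := by
    refine AEStronglyMeasurable.mul ?_ (AEStronglyMeasurable.mul ?_ hf.comp_snd)
    · exact ((measurable_fracKernel σ).comp (measurable_const.sub measurable_fst)).aestronglyMeasurable
    · exact ((measurable_fracKernel τ).comp (measurable_fst.sub measurable_snd)).aestronglyMeasurable
  have hG : Integrable
      (fun z : ℝ × ℝ => fracKernel σ (x - z.1) * (fracKernel τ (z.1 - z.2) * f z.2))
      (volume.prod volume) := by
    rw [integrable_prod_iff' hm]
    constructor
    · refine Eventually.of_forall fun y => ?_
      simpa only [mul_assoc] using (integral_fracKernel_mul hσ hτ x y).1.mul_const (f y)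
    · refine hx.norm.congr (Eventually.of_forall fun y => ?_)
      have e : (fun s => ‖fracKernel σ (x - s) * (fracKernel τ (s - y) * f y)‖) =
          fun s => fracKernel σ (x - s) * fracKernel τ (s - y) * ‖f y‖ := by
        funext s
        rw [norm_mul, norm_mul, Real.norm_of_nonneg (fracKernel_nonneg hσ _),
          Real.norm_of_nonneg (fracKernel_nonneg hτ _), mul_assoc]
      simp only [e]
      rw [integral_mul_const, (integral_fracKernel_mul hσ hτ x y).2, norm_mul,
        Real.norm_of_nonneg (fracKernel_nonneg (add_pos hσ hτ) _)]
  have e1 : ∀ s, ∫ y, fracKernel σ (x - s) * (fracKernel τ (s - y) * f y) =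
      fracKernel σ (x - s) * fracConv τ f s := fun s => by rw [integral_const_mul]; rfl
  constructor
  · simpa only [e1] using hG.integral_prod_left
  · have := integral_integral_swap
      (f := fun s y => fracKernel σ (x - s) * (fracKernel τ (s - y) * f y)) hG
    simp only [e1] at this
    rw [fracConv, this]
    refine integral_congr_ae (Eventually.of_forall fun y => ?_)
    simp only [← mul_assoc]
    rw [integral_mul_const, (integral_fracKernel_mul hσ hτ x y).2]

/-! ### Integrability of fractional integrals and integration by parts -/

/-- The factor `fracKernel 1 (1 - t)` is the cutoff to t < 1, so the semigroup lemma with one order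
equal to 1 supplies integrability of truncated kernels. The same device is reused below. -/
lemma integrable_fracKernel_near {σ : ℝ} (hσ : 0 < σ) :
    Integrable (fun t => fracKernel 1 (1 - t) * fracKernel σ t) := by
  simpa using (integral_fracKernel_mul one_pos hσ 1 0).1

/-- For σ ≤ 1 the kernel is nonincreasing on t > 0, so it splits into an L¹ part near 0 and a
bounded tail. -/
lemma fracKernel_le {σ : ℝ} (hσ : 0 < σ) (hσ1 : σ ≤ 1) (t : ℝ) :
    fracKernel σ t ≤ fracKernel 1 (1 - t) * fracKernel σ t + 1 / Real.Gamma σ := by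
  have hG := Real.Gamma_pos_of_pos hσ
  have hn := fracKernel_nonneg hσ t
  rw [fracKernel_one]
  split_ifs with h
  · have : 0 ≤ 1 / Real.Gamma σ := by positivity
    linarith
  · have ht : 1 ≤ t := by linarith
    rw [fracKernel_of_pos (by linarith), zero_mul, zero_add]
    exact div_le_div_of_nonneg_right (Real.rpow_le_one_of_one_le_of_nonpos ht (by linarith)) hG.le

lemma locallyIntegrable_fracKernel {σ : ℝ} (hσ : 0 < σ) : LocallyIntegrable (fracKernel σ) := by
  rw [locallyIntegrable_iff]
  intro K hK
  obtain ⟨B, hB⟩ := hK.bddAbove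
  have h := (integral_fracKernel_mul one_pos hσ (B + 1) 0).1.integrableOn (s := K)
  refine h.congr_fun (fun t ht => ?_) hK.measurableSet
  have := hB ht
  simp [fracKernel_one, show t < B + 1 by linarith]

/-- The L¹ part of the kernel is handled by Young's inequality and the bound on φ, the bounded part
by integrability of both f and φ. This justifies Fubini in the adjoint relation. -/
lemma integrable_fracKernel_prod {σ M : ℝ} (hσ : 0 < σ) (hσ1 : σ ≤ 1) {f φ : ℝ → ℝ}
    (hf : Integrable f) (hφ : Integrable φ) (hM : ∀ x, |φ x| ≤ M) :
    Integrable (fun z : ℝ × ℝ => fracKernel σ (z.1 - z.2) * f z.2 * φ z.1)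
      (volume.prod volume) := by
  have h1 := hf.convolution_integrand (ContinuousLinearMap.mul ℝ ℝ) (integrable_fracKernel_near hσ)
  have h2 := (hφ.mul_prod hf).norm.const_mul (1 / Real.Gamma σ)
  refine ((h1.norm.const_mul M).add h2).mono' ?_ (Eventually.of_forall fun z => ?_)
  · refine AEStronglyMeasurable.mul (AEStronglyMeasurable.mul ?_
      hf.aestronglyMeasurable.comp_snd) hφ.aestronglyMeasurable.comp_fst
    exact ((measurable_fracKernel σ).comp
      (measurable_fst.sub measurable_snd)).aestronglyMeasurable
  · have hk := fracKernel_nonneg hσ (z.1 - z.2)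
    have hk1 := fracKernel_nonneg one_pos (1 - (z.1 - z.2))
    have hle := fracKernel_le hσ hσ1 (z.1 - z.2)
    simp only [Pi.add_apply, ContinuousLinearMap.mul_apply', norm_mul, Real.norm_eq_abs,
      abs_of_nonneg hk, abs_of_nonneg hk1]
    have hA := mul_nonneg hk1 hk
    set A := fracKernel 1 (1 - (z.1 - z.2)) * fracKernel σ (z.1 - z.2)
    calc fracKernel σ (z.1 - z.2) * |f z.2| * |φ z.1|
        ≤ (A + 1 / Real.Gamma σ) * |f z.2| * |φ z.1| := by gcongr
      _ = A * |f z.2| * |φ z.1| + 1 / Real.Gamma σ * (|φ z.1| * |f z.2|) := by ring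
      _ ≤ A * |f z.2| * M + 1 / Real.Gamma σ * (|φ z.1| * |f z.2|) := by
          gcongr
          exact hM _
      _ = M * (|f z.2| * A) + 1 / Real.Gamma σ * (|φ z.1| * |f z.2|) := by ring

/-- Fractional integration by parts. -/
lemma fracConv_adjoint {σ M : ℝ} (hσ : 0 < σ) (hσ1 : σ ≤ 1) {f φ : ℝ → ℝ}
    (hf : Integrable f) (hφ : Integrable φ) (hM : ∀ x, |φ x| ≤ M) :
    Integrable (fun x => fracConv σ f x * φ x) ∧
      ∫ x, fracConv σ f x * φ x = ∫ y, f y * fracCoconv σ φ y := by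
  have hG := integrable_fracKernel_prod hσ hσ1 hf hφ hM
  have e1 : ∀ x, ∫ y, fracKernel σ (x - y) * f y * φ x = fracConv σ f x * φ x := fun x => by
    rw [integral_mul_const]; rfl
  have e2 : ∀ y, ∫ x, fracKernel σ (x - y) * f y * φ x = f y * fracCoconv σ φ y := fun y => by
    rw [fracCoconv, ← integral_const_mul]
    refine integral_congr_ae (Eventually.of_forall fun x => ?_)
    simp only
    ring
  refine ⟨by simpa only [e1] using hG.integral_prod_left, ?_⟩
  have := integral_integral_swap (f := fun x y => fracKernel σ (x - y) * f y * φ x) hG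
  simpa only [e1, e2] using this

lemma ae_integrable_fracKernel_mul {σ : ℝ} (hσ : 0 < σ) (hσ1 : σ ≤ 1) {f : ℝ → ℝ}
    (hf : Integrable f) : ∀ᵐ x, Integrable fun y => fracKernel σ (x - y) * f y := by
  -- The Gaussian is a strictly positive, bounded, integrable weight: Fubini gives integrable slices
  -- at a.e. x, and the weight can then be divided out.
  have hG := integrable_fracKernel_prod (φ := fun x => Real.exp (-1 * x ^ 2)) (M := 1) hσ hσ1 hf
    (integrable_exp_neg_mul_sq one_pos) (fun x => by
      rw [abs_of_pos (Real.exp_pos _)]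
      exact Real.exp_le_one_iff.2 (by nlinarith [sq_nonneg x]))
  filter_upwards [hG.prod_right_ae] with x hx
  refine (hx.mul_const (Real.exp (-1 * x ^ 2))⁻¹).congr (Eventually.of_forall fun y => ?_)
  have := (Real.exp_pos (-1 * x ^ 2)).ne'
  simp only
  field_simp

lemma locallyIntegrable_fracConv {σ : ℝ} (hσ : 0 < σ) (hσ1 : σ ≤ 1) {f : ℝ → ℝ}
    (hf : Integrable f) : LocallyIntegrable (fracConv σ f) := by
  rw [locallyIntegrable_iff]
  intro K hK
  have hi : Integrable (K.indicator fun _ => (1 : ℝ)) :=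
    (integrable_indicator_iff hK.measurableSet).2 (integrableOn_const hK.measure_lt_top.ne)
  have h := (fracConv_adjoint (M := 1) hσ hσ1 hf hi (fun x => by
    by_cases hx : x ∈ K <;> simp [hx])).1
  rw [← integrable_indicator_iff hK.measurableSet]
  refine h.congr (Eventually.of_forall fun x => ?_)
  by_cases hx : x ∈ K <;> simp [hx]

/-! ### Fractional integrals and derivatives as kernel convolutions -/

lemma leftFracInt_eq_fracConv {Ω : Set ℝ} (hΩ : MeasurableSet Ω) (σ : ℝ) (f : ℝ → ℝ) :
    leftFracInt Ω σ f = fracConv σ (Ω.indicator f) := by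
  funext x
  rw [leftFracInt, fracConv, ← integral_const_mul,
    ← integral_indicator (hΩ.inter measurableSet_Iio)]
  refine integral_congr_ae (Eventually.of_forall fun y => ?_)
  by_cases h1 : y ∈ Ω <;> by_cases h2 : y < x <;>
    simp [h1, h2, fracKernel, indicator]
  rw [show σ - 1 = -(1 - σ) by ring, Real.rpow_neg (by linarith)]
  field_simp

lemma rightFracInt_univ (σ : ℝ) (f : ℝ → ℝ) : rightFracInt univ σ f = fracCoconv σ f := by
  funext y
  rw [rightFracInt, fracCoconv, ← integral_const_mul, univ_inter,
    ← integral_indicator measurableSet_Ioi]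
  refine integral_congr_ae (Eventually.of_forall fun x => ?_)
  by_cases h2 : y < x <;> simp [h2, fracKernel, indicator]
  rw [show σ - 1 = -(1 - σ) by ring, Real.rpow_neg (by linarith)]
  field_simp

lemma fracCoconv_eq_convolution (σ : ℝ) (φ : ℝ → ℝ) :
    fracCoconv σ φ = convolution (fun t => fracKernel σ (-t)) φ
      (ContinuousLinearMap.mul ℝ ℝ) volume := by
  funext y
  rw [convolution_eq_swap]
  simp [fracCoconv]

/-- The derivative falls on the smooth compactly supported factor; the kernel only has to be locally
integrable. -/
lemma hasDerivAt_fracCoconv {σ : ℝ} (hσ : 0 < σ) {φ : ℝ → ℝ} (hφ : ContDiff ℝ 1 φ)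
    (hc : HasCompactSupport φ) (y : ℝ) :
    HasDerivAt (fracCoconv σ φ) (fracCoconv σ (deriv φ) y) y := by
  simp only [fracCoconv_eq_convolution]
  refine hc.hasDerivAt_convolution_right _ ?_ hφ y
  exact (locallyIntegrable_map_homeomorph (Homeomorph.neg ℝ) (f := fracKernel σ)
    (μ := volume)).1 (by
      rw [show ((Homeomorph.neg ℝ : ℝ ≃ₜ ℝ) : ℝ → ℝ) = Neg.neg from rfl, Measure.map_neg_eq_self]
      exact locallyIntegrable_fracKernel hσ)

lemma rightFracDeriv_eq {α : ℝ} (hα : α < 1) {φ : ℝ → ℝ} (hφ : ContDiff ℝ 1 φ)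
    (hc : HasCompactSupport φ) (y : ℝ) :
    rightFracDeriv α φ y = - fracCoconv (1 - α) (deriv φ) y := by
  rw [rightFracDeriv, rightFracInt_univ, (hasDerivAt_fracCoconv (by linarith) hφ hc y).deriv]

lemma fracCoconv_one_deriv {φ : ℝ → ℝ} (hφ : ContDiff ℝ 1 φ) (hc : HasCompactSupport φ) (y : ℝ) :
    fracCoconv 1 (deriv φ) y = - φ y := by
  rw [← hc.integral_Ioi_deriv_eq hφ y, ← integral_indicator measurableSet_Ioi]
  refine integral_congr_ae (Eventually.of_forall fun x => ?_)
  simp [fracKernel_one, indicator]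

/-! ### Test functions and the weak formulation -/

lemma IsTestFunction.contDiff_one {Ω : Set ℝ} {φ : ℝ → ℝ} (h : IsTestFunction Ω φ) :
    ContDiff ℝ 1 φ := h.smooth.of_le (by exact_mod_cast le_top)

lemma IsTestFunction.integrable_deriv {Ω : Set ℝ} {φ : ℝ → ℝ} (h : IsTestFunction Ω φ) :
    Integrable (deriv φ) :=
  (h.contDiff_one.continuous_deriv le_rfl).integrable_of_hasCompactSupport h.compact.deriv

lemma IsTestFunction.exists_bound_deriv {Ω : Set ℝ} {φ : ℝ → ℝ} (h : IsTestFunction Ω φ) :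
    ∃ M, ∀ x, |deriv φ x| ≤ M :=
  (h.contDiff_one.continuous_deriv le_rfl).bounded_above_of_compact_support h.compact.deriv

lemma IsTestFunction.integrable {Ω : Set ℝ} {φ : ℝ → ℝ} (h : IsTestFunction Ω φ) :
    Integrable φ :=
  h.smooth.continuous.integrable_of_hasCompactSupport h.compact

lemma IsTestFunction.deriv_eq_zero {Ω : Set ℝ} {φ : ℝ → ℝ} (h : IsTestFunction Ω φ) {x : ℝ}
    (hx : x ∉ Ω) : deriv φ x = 0 :=
  image_eq_zero_of_notMem_tsupport fun hx' => hx (h.support (tsupport_deriv_subset hx'))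

lemma IsTestFunction.integral_fracConv_mul_deriv {Ω : Set ℝ} {φ : ℝ → ℝ} (h : IsTestFunction Ω φ)
    {σ : ℝ} (hσ : 0 < σ) (hσ1 : σ ≤ 1) {f : ℝ → ℝ} (hf : Integrable f) :
    Integrable (fun x => fracConv σ f x * deriv φ x) ∧
      ∫ x, fracConv σ f x * deriv φ x = ∫ y, f y * fracCoconv σ (deriv φ) y := by
  obtain ⟨M, hM⟩ := h.exists_bound_deriv
  exact fracConv_adjoint hσ hσ1 hf h.integrable_deriv hM

lemma IsTestFunction.integral_fracConv_one_mul_deriv {Ω : Set ℝ} {φ : ℝ → ℝ}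
    (h : IsTestFunction Ω φ) {f : ℝ → ℝ} (hf : Integrable f) :
    ∫ x, fracConv 1 f x * deriv φ x = - ∫ y, f y * φ y := by
  rw [(h.integral_fracConv_mul_deriv one_pos le_rfl hf).2, ← integral_neg]
  simp only [fracCoconv_one_deriv h.contDiff_one h.compact, mul_neg]

/-- This recasts the weak derivative of order α as an ordinary weak derivative of I^(1-α)u: the
right derivative of φ is minus the right integral of φ', and the adjoint relation moves that
integral onto u. -/
lemma setIntegral_mul_rightFracDeriv {Ω : Set ℝ} (hΩ : MeasurableSet Ω) {φ : ℝ → ℝ}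
    (h : IsTestFunction Ω φ) {α : ℝ} (hα : 0 < α) (hα1 : α < 1) {u : ℝ → ℝ}
    (hu : IntegrableOn u Ω) :
    ∫ x in Ω, u x * rightFracDeriv α φ x =
      - ∫ x, fracConv (1 - α) (Ω.indicator u) x * deriv φ x := by
  rw [(h.integral_fracConv_mul_deriv (by linarith) (by linarith)
    ((integrable_indicator_iff hΩ).2 hu)).2, ← integral_neg, ← integral_indicator hΩ]
  refine integral_congr_ae (Eventually.of_forall fun x => ?_)
  by_cases hx : x ∈ Ω <;> simp [hx, rightFracDeriv_eq hα1 h.contDiff_one h.compact]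

/-! ### The du Bois-Reymond lemma and its consequence for I^(1-β)u -/

/-- A compact subset of an open interval lies in the interior of a compact subinterval. -/
lemma exists_Ioo_Icc_of_isCompact {Ω K : Set ℝ} (hΩ : IsOpen Ω) (hc : Ω.OrdConnected)
    (hne : Ω.Nonempty) (hK : IsCompact K) (hKΩ : K ⊆ Ω) :
    ∃ p q, p ≤ q ∧ K ⊆ Ioo p q ∧ Icc p q ⊆ Ω := by
  obtain ⟨x0, hx0⟩ := hne
  have hK' : IsCompact (insert x0 K) := hK.insert x0
  have hK'Ω : insert x0 K ⊆ Ω := insert_subset hx0 hKΩ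
  obtain ⟨m, hm, hm'⟩ := hK'.exists_isLeast ⟨x0, mem_insert _ _⟩
  obtain ⟨n, hn, hn'⟩ := hK'.exists_isGreatest ⟨x0, mem_insert _ _⟩
  obtain ⟨l, _, hl, hlΩ⟩ := mem_nhds_iff_exists_Ioo_subset.1 (hΩ.mem_nhds (hK'Ω hm))
  obtain ⟨_, r, hr, hrΩ⟩ := mem_nhds_iff_exists_Ioo_subset.1 (hΩ.mem_nhds (hK'Ω hn))
  have hmn : m ≤ n := hm' hn
  have h1 := hl.1
  have h2 := hl.2
  have h3 := hr.1
  have h4 := hr.2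
  refine ⟨(l + m) / 2, (n + r) / 2, by linarith, fun x hx => ?_, ?_⟩
  · have h5 := hm' (mem_insert_of_mem _ hx)
    have h6 := hn' (mem_insert_of_mem _ hx)
    constructor <;> linarith
  · exact hc.out (hlΩ ⟨by linarith, by linarith⟩) (hrΩ ⟨by linarith, by linarith⟩)

/-- The primitive started to the left of the support vanishes again to the right of it because the
mean is zero, so its support stays in a compact subinterval of Ω. -/
lemma IsTestFunction.exists_primitive {Ω : Set ℝ} (hΩ : IsOpen Ω) (hc : Ω.OrdConnected)
    (hne : Ω.Nonempty) {ρ : ℝ → ℝ} (hρ : IsTestFunction Ω ρ) (h0 : ∫ x, ρ x = 0) :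
    ∃ φ, IsTestFunction Ω φ ∧ deriv φ = ρ := by
  obtain ⟨p, q, hpq, hK, hpqΩ⟩ := exists_Ioo_Icc_of_isCompact hΩ hc hne hρ.compact hρ.support
  have hsupp : Function.support ρ ⊆ Ioo p q := (subset_tsupport ρ).trans hK
  set φ : ℝ → ℝ := fun x => ∫ t in p..x, ρ t with hφ
  have hd : ∀ x, HasDerivAt φ (ρ x) x := fun x =>
    intervalIntegral.integral_hasDerivAt_right (hρ.smooth.continuous.intervalIntegrable _ _)
      (hρ.smooth.continuous.stronglyMeasurableAtFilter _ _) hρ.smooth.continuous.continuousAt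
  have hder : deriv φ = ρ := funext fun x => (hd x).deriv
  have hz : ∀ x, x ∉ Icc p q → φ x = 0 := by
    intro x hx
    rcases lt_or_ge x p with h | h
    · refine intervalIntegral.integral_zero_ae (Eventually.of_forall fun t ht => ?_)
      rw [uIoc_of_ge h.le] at ht
      by_contra hne
      exact absurd (hsupp hne).1 (not_lt.2 ht.2)
    · have hq : q < x := by
        by_contra hq
        exact hx ⟨h, not_lt.1 hq⟩
      rw [hφ]
      simp only
      rw [intervalIntegral.integral_eq_integral_of_support_subset, h0]
      exact hsupp.trans fun t ht => ⟨ht.1, (ht.2.trans hq).le⟩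
  have ht : tsupport φ ⊆ Icc p q :=
    closure_minimal (fun x hx => by_contra fun h => hx (hz x h)) isClosed_Icc
  refine ⟨φ, ⟨?_, ?_, ht.trans hpqΩ⟩, hder⟩
  · rw [contDiff_infty_iff_deriv, hder]
    exact ⟨fun x => (hd x).differentiableAt, hρ.smooth⟩
  · exact isCompact_Icc.of_isClosed_subset (isClosed_tsupport φ) ht

lemma exists_isTestFunction_integral_one {Ω : Set ℝ} (hΩ : IsOpen Ω) (hne : Ω.Nonempty) :
    ∃ η, IsTestFunction Ω η ∧ ∫ x, η x = 1 := by
  obtain ⟨x0, hx0⟩ := hne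
  obtain ⟨ε, hε, hb⟩ := Metric.isOpen_iff.1 hΩ x0 hx0
  let f : ContDiffBump x0 := ⟨ε / 4, ε / 2, by linarith, by linarith⟩
  refine ⟨f.normed volume, ⟨f.contDiff_normed, f.hasCompactSupport_normed, ?_⟩, f.integral_normed⟩
  rw [f.tsupport_normed_eq]
  exact (Metric.closedBall_subset_ball (by simp only [f]; linarith)).trans hb

/-- Lemma of du Bois-Reymond. -/
lemma ae_eq_const_of_integral_mul_deriv_eq_zero {Ω : Set ℝ} (hΩ : IsOpen Ω)
    (hc : Ω.OrdConnected) (hne : Ω.Nonempty) {H : ℝ → ℝ} (hH : LocallyIntegrable H)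
    (h : ∀ φ, IsTestFunction Ω φ → ∫ x, H x * deriv φ x = 0) :
    ∃ C, ∀ᵐ x, x ∈ Ω → H x = C := by
  obtain ⟨η, hη, hη1⟩ := exists_isTestFunction_integral_one hΩ hne
  refine ⟨∫ x, H x * η x, ?_⟩
  set C := ∫ x, H x * η x
  have hI : ∀ g, IsTestFunction Ω g → Integrable fun x => H x * g x := fun g hg => by
    simpa only [smul_eq_mul, mul_comm] using
      hH.integrable_smul_left_of_hasCompactSupport hg.smooth.continuous hg.compact
  have key : ∀ᵐ x, x ∈ Ω → H x - C = 0 := by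
    refine hΩ.ae_eq_zero_of_integral_contDiff_smul_eq_zero
      ((hH.sub (locallyIntegrable_const C)).locallyIntegrableOn Ω) fun g h1 h2 h3 => ?_
    have hg : IsTestFunction Ω g := ⟨h1, h2, h3⟩
    -- Subtracting a multiple of the unit-mass η makes the mean zero, so the difference is the
    -- derivative of a test function and the hypothesis applies.
    have hρ : IsTestFunction Ω (fun x => g x - (∫ y, g y) * η x) := by
      refine ⟨h1.sub (contDiff_const.mul hη.smooth), ?_, ?_⟩
      · exact h2.sub hη.compact.mul_left
      · refine (tsupport_sub _ _).trans (union_subset h3 ?_)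
        exact (tsupport_mul_subset_right).trans hη.support
    obtain ⟨φ, hφ, hd⟩ := hρ.exists_primitive hΩ hc hne (by
      rw [integral_sub hg.integrable (hη.integrable.const_mul _), integral_const_mul, hη1]
      ring)
    have h4 := h φ hφ
    rw [hd] at h4
    have e : ∀ x, H x * (g x - (∫ y, g y) * η x) = H x * g x - (∫ y, g y) * (H x * η x) :=
      fun x => by ring
    simp only [e] at h4
    rw [integral_sub (hI g hg) ((hI η hη).const_mul _), integral_const_mul] at h4
    have e' : ∀ x, g x • (H x - C) = H x * g x - C * g x := fun x => by
      simp only [smul_eq_mul]; ring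
    simp only [e']
    rw [integral_sub (hI g hg) (hg.integrable.const_mul _), integral_const_mul]
    linarith
  filter_upwards [key] with x hx hxΩ
  linarith [hx hxΩ]

/-- The fractional integral of order `1 - β` of a function with a weak derivative of order `β`
is absolutely continuous. -/
lemma IsLeftWeakFracDeriv.exists_fracConv_eq {Ω : Set ℝ} (hΩ : IsOpen Ω) (hc : Ω.OrdConnected)
    (hne : Ω.Nonempty) {β : ℝ} (hβ : 0 < β) (hβ1 : β < 1) {u v : ℝ → ℝ}
    (h : IsLeftWeakFracDeriv Ω β u v) (hv : IntegrableOn v Ω) :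
    ∃ C, ∀ᵐ x, x ∈ Ω →
      fracConv (1 - β) (Ω.indicator u) x = C + fracConv 1 (Ω.indicator v) x := by
  have hu0 := (integrable_indicator_iff hΩ.measurableSet).2 h.integrableOn
  have hv0 := (integrable_indicator_iff hΩ.measurableSet).2 hv
  obtain ⟨C, hC⟩ := ae_eq_const_of_integral_mul_deriv_eq_zero hΩ hc hne
    (H := fun x => fracConv (1 - β) (Ω.indicator u) x - fracConv 1 (Ω.indicator v) x)
    ((locallyIntegrable_fracConv (by linarith) (by linarith) hu0).sub
      (locallyIntegrable_fracConv one_pos le_rfl hv0)) (fun φ hφ => by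
      simp only [sub_mul]
      rw [integral_sub (hφ.integral_fracConv_mul_deriv (by linarith) (by linarith) hu0).1
        (hφ.integral_fracConv_mul_deriv one_pos le_rfl hv0).1,
        hφ.integral_fracConv_one_mul_deriv hv0]
      have h1 := h.integral_eq φ hφ
      rw [setIntegral_mul_rightFracDeriv hΩ.measurableSet hφ hβ hβ1 h.integrableOn,
        ← integral_indicator hΩ.measurableSet] at h1
      have e : ∫ x, Ω.indicator v x * φ x = ∫ x, Ω.indicator (fun x => v x * φ x) x :=
        integral_congr_ae (Eventually.of_forall fun x => by
          by_cases hx : x ∈ Ω <;> simp [hx])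
      linarith)
  exact ⟨C, hC.mono fun x hx hxΩ => by linarith [hx hxΩ]⟩

/-! ### The finite interval -/

/-- The candidate `C (x - a)₊^(σ - 1) / Γ(σ) + I^σ g` for a fractional derivative on `(a, b)`. -/
noncomputable def kernelAddFracConv (a C σ : ℝ) (g : ℝ → ℝ) (x : ℝ) : ℝ :=
  C * fracKernel σ (x - a) + fracConv σ g x

lemma fracConv_eq_zero {a σ x : ℝ} {f : ℝ → ℝ} (hf : ∀ y ≤ a, f y = 0) (hx : x ≤ a) :
    fracConv σ f x = 0 := by
  rw [fracConv, ← integral_zero ℝ ℝ]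
  refine integral_congr_ae (Eventually.of_forall fun y => ?_)
  rcases le_or_gt y a with h | h
  · simp [hf y h]
  · simp [fracKernel_of_nonpos (by linarith : x - y ≤ 0)]

/-- `fracConv σ f x` only depends on `f` to the left of `x`. -/
lemma fracConv_congr {σ b x : ℝ} {f g : ℝ → ℝ} (h : ∀ᵐ y, y < b → f y = g y) (hx : x ≤ b) :
    (fun y => fracKernel σ (x - y) * f y) =ᵐ[volume] fun y => fracKernel σ (x - y) * g y := by
  filter_upwards [h] with y hy
  rcases lt_or_ge y b with h1 | h1
  · rw [hy h1]
  · rw [fracKernel_of_nonpos (by linarith : x - y ≤ 0), zero_mul, zero_mul]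

/-- For order at least 1 the kernel is bounded on bounded sets, and only y in (a, x) contributes.
Hence integrability holds at every x, not merely almost every x. -/
lemma integrable_fracKernel_mul_of_one_le {σ : ℝ} (hσ : 1 ≤ σ) {f : ℝ → ℝ} (hf : Integrable f)
    {a : ℝ} (ha : ∀ y ≤ a, f y = 0) (x : ℝ) :
    Integrable fun y => fracKernel σ (x - y) * f y := by
  have hG := Real.Gamma_pos_of_pos (by linarith : 0 < σ)
  refine (hf.norm.const_mul (|x - a| ^ (σ - 1) / Real.Gamma σ)).mono' ?_
    (Eventually.of_forall fun y => ?_)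
  · exact ((measurable_fracKernel σ).comp
      (measurable_const.sub measurable_id)).aestronglyMeasurable.mul hf.aestronglyMeasurable
  · rw [norm_mul, Real.norm_of_nonneg (fracKernel_nonneg (by linarith) _)]
    rcases le_or_gt y a with h | h
    · simp [ha y h]
    · refine mul_le_mul_of_nonneg_right ?_ (norm_nonneg _)
      rcases le_or_gt (x - y) 0 with h1 | h1
      · rw [fracKernel_of_nonpos h1]
        positivity
      · rw [fracKernel_of_pos h1]
        refine div_le_div_of_nonneg_right (Real.rpow_le_rpow h1.le ?_ (by linarith)) hG.le
        exact le_trans (by linarith) (le_abs_self _)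

lemma fracConv_kernelAddFracConv {σ τ a C x : ℝ} (hσ : 0 < σ) (hτ : 0 < τ) {g : ℝ → ℝ}
    (hg : AEStronglyMeasurable g)
    (hx : Integrable fun y => fracKernel (σ + τ) (x - y) * g y) :
    fracConv σ (kernelAddFracConv a C τ g) x = kernelAddFracConv a C (σ + τ) g x := by
  obtain ⟨h1, h2⟩ := fracConv_fracConv hσ hτ hg hx
  have h3 := (integral_fracKernel_mul hσ hτ x a).1
  have e : ∀ s, fracKernel σ (x - s) * kernelAddFracConv a C τ g s =
      C * (fracKernel σ (x - s) * fracKernel τ (s - a)) +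
        fracKernel σ (x - s) * fracConv τ g s := fun s => by
    rw [kernelAddFracConv]; ring
  rw [fracConv]
  simp only [e]
  rw [integral_add (h3.const_mul C) h1, integral_const_mul,
    (integral_fracKernel_mul hσ hτ x a).2, kernelAddFracConv, ← h2]
  rfl

lemma kernelAddFracConv_eq_zero {a C σ : ℝ} {g : ℝ → ℝ} (hg : ∀ y ≤ a, g y = 0) {x : ℝ}
    (hx : x ≤ a) : kernelAddFracConv a C σ g x = 0 := by
  rw [kernelAddFracConv, fracConv_eq_zero hg hx, fracKernel_of_nonpos (by linarith)]
  ring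

lemma locallyIntegrable_kernelAddFracConv {a C σ : ℝ} (hσ : 0 < σ) (hσ1 : σ ≤ 1) {g : ℝ → ℝ}
    (hg : Integrable g) : LocallyIntegrable (kernelAddFracConv a C σ g) := by
  refine LocallyIntegrable.add ?_ (locallyIntegrable_fracConv hσ hσ1 hg)
  have h : LocallyIntegrable (fun x => fracKernel σ (x - a)) :=
    (locallyIntegrable_map_homeomorph (Homeomorph.subRight a) (f := fracKernel σ)
      (μ := volume)).1 (by
        rw [show ((Homeomorph.subRight a : ℝ ≃ₜ ℝ) : ℝ → ℝ) = fun x => x - a from rfl,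
          (measurePreserving_sub_right volume a).map_eq]
        exact locallyIntegrable_fracKernel hσ)
  exact h.smul C

/-- Two integrable functions whose primitives differ by a constant agree. -/
lemma ae_eq_of_fracConv_one_eq_const_add {f g : ℝ → ℝ} {D : ℝ} (hf : Integrable f)
    (hg : Integrable g) {U : Set ℝ} (hU : IsOpen U)
    (h : ∀ᵐ x, x ∈ U → fracConv 1 f x = D + fracConv 1 g x) :
    ∀ᵐ x, x ∈ U → f x = g x := by
  have key : ∀ᵐ x, x ∈ U → f x - g x = 0 := by
    refine hU.ae_eq_zero_of_integral_contDiff_smul_eq_zero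
      ((hf.sub hg).locallyIntegrable.locallyIntegrableOn U) fun φ h1 h2 h3 => ?_
    have hφ : IsTestFunction U φ := ⟨h1, h2, h3⟩
    have hI : ∀ {w : ℝ → ℝ}, Integrable w → Integrable fun x => w x * φ x := fun hw => by
      simpa only [smul_eq_mul, mul_comm] using
        hw.locallyIntegrable.integrable_smul_left_of_hasCompactSupport h1.continuous h2
    -- Since φ' has mean zero, the constant D drops out of the pairing.
    have h0 : ∫ x, deriv φ x = 0 := integral_eq_zero_of_hasDerivAt_of_integrable
      (fun x => (hφ.contDiff_one.differentiable one_ne_zero x).hasDerivAt) hφ.integrable_deriv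
      hφ.integrable
    have e : ∫ x, fracConv 1 f x * deriv φ x =
        ∫ x, (D * deriv φ x + fracConv 1 g x * deriv φ x) := by
      refine integral_congr_ae ?_
      filter_upwards [h] with x hx
      by_cases hxU : x ∈ U
      · rw [hx hxU, add_mul]
      · rw [hφ.deriv_eq_zero hxU, mul_zero, mul_zero, mul_zero, add_zero]
    rw [integral_add (hφ.integrable_deriv.const_mul D)
      (hφ.integral_fracConv_mul_deriv one_pos le_rfl hg).1, integral_const_mul, h0, mul_zero,
      zero_add, hφ.integral_fracConv_one_mul_deriv hf,
      hφ.integral_fracConv_one_mul_deriv hg] at e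
    have e' : ∀ x, φ x • (f x - g x) = f x * φ x - g x * φ x := fun x => by
      simp only [smul_eq_mul]; ring
    simp only [e']
    rw [integral_sub (hI hf) (hI hg)]
    linarith
  filter_upwards [key] with x hx hxU
  linarith [hx hxU]

section Interval

variable {a b β C : ℝ} {f g : ℝ → ℝ}

/-- Lowering the order in `I^(1-β) f = C + I^1 g`. -/
lemma fracConv_eq_fracConv_one {α : ℝ} (hαβ : α < β) (hβ1 : β < 1)
    (hf : Integrable f) (hg : Integrable g) (hf0 : ∀ y ≤ a, f y = 0) (hg0 : ∀ y ≤ a, g y = 0)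
    (hF : ∀ᵐ x, x ∈ Ioo a b → fracConv (1 - β) f x = C + fracConv 1 g x) {x : ℝ} (hxb : x ≤ b)
    (hx : Integrable fun y => fracKernel (1 - α) (x - y) * f y) :
    fracConv (1 - α) f x = fracConv 1 (kernelAddFracConv a C (β - α) g) x := by
  -- Both sides vanish for s ≤ a, so the identity extends to all s < b, the constant C becoming C
  -- times the kernel of order 1 based at a.
  have hF' : ∀ᵐ s, s < b → fracConv (1 - β) f s = kernelAddFracConv a C 1 g s := by
    filter_upwards [hF] with s hs hsb
    rcases le_or_gt s a with h | h
    · rw [kernelAddFracConv_eq_zero hg0 h, fracConv_eq_zero hf0 h]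
    · rw [hs ⟨h, hsb⟩, kernelAddFracConv, fracKernel_one, if_pos (by linarith), mul_one]
  have hi := integrable_fracKernel_mul_of_one_le (σ := β - α + 1) (by linarith) hg hg0 x
  have h1 := (fracConv_fracConv (σ := β - α) (τ := 1 - β) (x := x) (by linarith) (by linarith)
    hf.aestronglyMeasurable (by rwa [show β - α + (1 - β) = 1 - α by ring])).2
  rw [show β - α + (1 - β) = 1 - α by ring] at h1
  rw [← h1, fracConv, integral_congr_ae (fracConv_congr hF' hxb)]
  change fracConv (β - α) (kernelAddFracConv a C 1 g) x = _
  rw [fracConv_kernelAddFracConv (by linarith) one_pos hg.aestronglyMeasurable hi,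
    fracConv_kernelAddFracConv one_pos (by linarith) hg.aestronglyMeasurable
      (by rwa [add_comm 1 (β - α)]), add_comm]

lemma integrable_indicator_kernelAddFracConv {σ : ℝ} (hσ : 0 < σ) (hσ1 : σ ≤ 1)
    (hg : Integrable g) : Integrable ((Ioo a b).indicator (kernelAddFracConv a C σ g)) :=
  (integrable_indicator_iff measurableSet_Ioo).2
    (((locallyIntegrable_kernelAddFracConv hσ hσ1 hg).integrableOn_isCompact
      isCompact_Icc).mono_set Ioo_subset_Icc_self)

lemma fracConv_indicator_kernelAddFracConv {σ τ : ℝ} (hg0 : ∀ y ≤ a, g y = 0) {x : ℝ}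
    (hxb : x ≤ b) :
    fracConv σ ((Ioo a b).indicator (kernelAddFracConv a C τ g)) x =
      fracConv σ (kernelAddFracConv a C τ g) x := by
  refine integral_congr_ae (fracConv_congr (Eventually.of_forall fun y hy => ?_) hxb)
  rcases le_or_gt y a with h | h
  · rw [kernelAddFracConv_eq_zero hg0 h, indicator_of_notMem (fun hy => absurd hy.1 h.not_gt)]
  · rw [indicator_of_mem (show y ∈ Ioo a b from ⟨h, hy⟩)]

lemma ae_fracConv_eq_fracConv_one {α : ℝ} (hα : 0 ≤ α) (hαβ : α < β) (hβ1 : β < 1)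
    (hf : Integrable f) (hg : Integrable g) (hf0 : ∀ y ≤ a, f y = 0) (hg0 : ∀ y ≤ a, g y = 0)
    (hF : ∀ᵐ x, x ∈ Ioo a b → fracConv (1 - β) f x = C + fracConv 1 g x) :
    ∀ᵐ x, x < b → fracConv (1 - α) f x =
      fracConv 1 ((Ioo a b).indicator (kernelAddFracConv a C (β - α) g)) x := by
  filter_upwards [ae_integrable_fracKernel_mul (σ := 1 - α) (by linarith) (by linarith) hf]
    with x hx hxb
  rw [fracConv_indicator_kernelAddFracConv hg0 hxb.le,
    fracConv_eq_fracConv_one hαβ hβ1 hf hg hf0 hg0 hF hxb.le hx]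

/-- The a.e. identity `I^(1-β) f = C + I^1 g` holds everywhere. -/
lemma fracConv_eq_of_ae (hβ : 0 < β) (hβ1 : β < 1)
    (hf : Integrable f) (hg : Integrable g) (hf0 : ∀ y ≤ a, f y = 0) (hg0 : ∀ y ≤ a, g y = 0)
    (hF : ∀ᵐ x, x ∈ Ioo a b → fracConv (1 - β) f x = C + fracConv 1 g x) {x : ℝ}
    (hx : x ∈ Ioo a b) : fracConv (1 - β) f x = C + fracConv 1 g x := by
  -- At α = 0 this reads I^1 f = I^1 W with W of order β, so uniqueness of primitives gives f = W
  -- a.e. to the left of b. Integrals ignore null sets, so I^(1-β)f can then be computed at every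
  -- point.
  have h1 := ae_fracConv_eq_fracConv_one le_rfl hβ hβ1 hf hg hf0 hg0 hF
  rw [sub_zero, sub_zero] at h1
  have h2 := ae_eq_of_fracConv_one_eq_const_add (D := 0) hf (integrable_indicator_kernelAddFracConv hβ hβ1.le hg)
    isOpen_Iio (by simpa only [zero_add, mem_Iio] using h1)
  rw [fracConv, integral_congr_ae (fracConv_congr h2 hx.2.le)]
  change fracConv _ _ x = _
  rw [fracConv_indicator_kernelAddFracConv hg0 hx.2.le, fracConv_kernelAddFracConv (by linarith) hβ
    hg.aestronglyMeasurable (integrable_fracKernel_mul_of_one_le (by linarith) hg hg0 x),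
    sub_add_cancel, kernelAddFracConv, fracKernel_one, if_pos (by linarith [hx.1]), mul_one]

lemma tendsto_fracConv_one (hg : Integrable g) (hg0 : ∀ y ≤ a, g y = 0) :
    Tendsto (fracConv 1 g) (𝓝[>] a) (𝓝 0) := by
  have hc := intervalIntegral.continuous_primitive (fun p q => hg.intervalIntegrable (a := p)
    (b := q)) a
  have h1 : Tendsto (fun x => ∫ y in a..x, g y) (𝓝[>] a) (𝓝 0) := by
    have := (hc.tendsto a).mono_left (nhdsWithin_le_nhds (s := Ioi a))
    rwa [intervalIntegral.integral_same] at this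
  refine h1.congr' ?_
  filter_upwards [self_mem_nhdsWithin] with x hx
  rw [intervalIntegral.integral_of_le (le_of_lt hx), integral_Ioc_eq_integral_Ioo,
    ← integral_indicator measurableSet_Ioo, fracConv]
  refine integral_congr_ae (Eventually.of_forall fun y => ?_)
  by_cases h1 : a < y
  · by_cases h2 : y < x <;> simp [h1, h2, fracKernel_one, indicator]
  · simp [h1, hg0 y (not_lt.1 h1)]

end Interval

theorem IsLeftWeakFracDeriv.of_lt_Ioo {α β : ℝ} (hα : 0 < α) (hαβ : α < β) (hβ : β < 1)
    {a b : ℝ} (hab : a < b) {u v : ℝ → ℝ} (h : IsLeftWeakFracDeriv (Ioo a b) β u v)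
    (hv : IntegrableOn v (Ioo a b)) :
    ∃ l c : ℝ,
      Tendsto (leftFracInt (Ioo a b) (1 - β) u) (𝓝[>] a) (𝓝 l) ∧
      c = l / Real.Gamma (β - α) ∧
      IntegrableOn
        (fun x => c * leftKernel a (β - α) x + leftFracInt (Ioo a b) (β - α) v x)
        (Ioo a b) ∧
      IsLeftWeakFracDeriv (Ioo a b) α u
        (fun x => c * leftKernel a (β - α) x + leftFracInt (Ioo a b) (β - α) v x) := by
  obtain ⟨C, hF⟩ := h.exists_fracConv_eq isOpen_Ioo ordConnected_Ioo (nonempty_Ioo.2 hab)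
    (by linarith) hβ hv
  have hu0 := (integrable_indicator_iff measurableSet_Ioo).2 h.integrableOn
  have hv0 := (integrable_indicator_iff measurableSet_Ioo).2 hv
  have hz : ∀ w : ℝ → ℝ, ∀ y ≤ a, (Ioo a b).indicator w y = 0 := fun w y hy =>
    indicator_of_notMem (fun hy' => absurd hy'.1 hy.not_gt) _
  set W := kernelAddFracConv a C (β - α) ((Ioo a b).indicator v) with hW
  have hWi : Integrable ((Ioo a b).indicator W) :=
    integrable_indicator_kernelAddFracConv (by linarith) (by linarith) hv0
  have hWeq : ∀ x ∈ Ioo a b, W x = C / Real.Gamma (β - α) * leftKernel a (β - α) x +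
      leftFracInt (Ioo a b) (β - α) v x := fun x hx => by
    rw [hW, kernelAddFracConv, leftFracInt_eq_fracConv measurableSet_Ioo,
      fracKernel_of_pos (by linarith [hx.1]), leftKernel]
    ring
  have hWon : IntegrableOn (fun x => C / Real.Gamma (β - α) * leftKernel a (β - α) x +
      leftFracInt (Ioo a b) (β - α) v x) (Ioo a b) :=
    ((integrable_indicator_iff measurableSet_Ioo).1 hWi).congr_fun hWeq measurableSet_Ioo
  -- The limit is the du Bois-Reymond constant itself, since I^1 v tends to 0 at a.
  refine ⟨C, C / Real.Gamma (β - α), ?_, rfl, hWon,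
    h.integrableOn, hWon.locallyIntegrableOn, fun φ hφ => ?_⟩
  · have := (tendsto_fracConv_one hv0 (hz v)).const_add C
    rw [add_zero] at this
    refine this.congr' ?_
    filter_upwards [Ioo_mem_nhdsGT hab] with x hx
    rw [leftFracInt_eq_fracConv measurableSet_Ioo,
      fracConv_eq_of_ae (by linarith) hβ hu0 hv0 (hz u) (hz v) hF hx]
  · rw [setIntegral_mul_rightFracDeriv measurableSet_Ioo hφ hα (by linarith) h.integrableOn]
    have e1 : ∫ x, fracConv (1 - α) ((Ioo a b).indicator u) x * deriv φ x =
        ∫ x, fracConv 1 ((Ioo a b).indicator W) x * deriv φ x := by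
      refine integral_congr_ae ?_
      filter_upwards [ae_fracConv_eq_fracConv_one hα.le hαβ hβ hu0 hv0 (hz u) (hz v) hF] with x hx
      by_cases hxU : x ∈ Ioo a b
      · rw [hx hxU.2]
      · rw [hφ.deriv_eq_zero hxU, mul_zero, mul_zero]
    rw [e1, hφ.integral_fracConv_one_mul_deriv hWi, neg_neg,
      ← integral_indicator measurableSet_Ioo]
    refine integral_congr_ae (Eventually.of_forall fun x => ?_)
    by_cases hx : x ∈ Ioo a b <;> simp [hx, hWeq]

/-! ### The L¹ modulus of continuity on the real line -/

/-- Backward difference with step `t` of the kernel of order `β`. -/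
noncomputable def fracKernelDiff (β t s : ℝ) : ℝ := fracKernel β s - fracKernel β (s - t)

lemma measurable_fracKernelDiff (β t : ℝ) : Measurable (fracKernelDiff β t) :=
  (measurable_fracKernel β).sub ((measurable_fracKernel β).comp (measurable_id.sub_const t))

lemma abs_fracKernelDiff_one_le {β s : ℝ} (hβ : 0 < β) (hβ1 : β < 1) (hs : 3 ≤ s) :
    |fracKernelDiff β 1 s| ≤ 2 ^ (1 - β) / Real.Gamma β * s ^ (β - 2) := by
  have hG := Real.Gamma_pos_of_pos hβ
  have hs0 : 0 < s := by linarith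
  rw [fracKernelDiff, fracKernel_of_pos hs0, fracKernel_of_pos (by linarith), ← sub_div, abs_div,
    abs_of_pos hG, div_mul_eq_mul_div]
  refine div_le_div_of_nonneg_right ?_ hG.le
  have h1 : s ^ (β - 1) ≤ (s - 1) ^ (β - 1) :=
    Real.rpow_le_rpow_of_nonpos (by linarith) (by linarith) (by linarith)
  have h2 : (s - 1) ^ (β - 1) ≤ (s / 2) ^ (β - 1) :=
    Real.rpow_le_rpow_of_nonpos (by linarith) (by linarith) (by linarith)
  -- Monotonicity of s^β replaces the mean value theorem: it bounds s((s-1)^(β-1) - s^(β-1)) by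
  -- (s-1)^(β-1).
  have h3 : (s - 1) ^ (β - 1) * (s - 1) ≤ s ^ (β - 1) * s := by
    rw [← Real.rpow_add_one (by linarith), ← Real.rpow_add_one hs0.ne', sub_add_cancel]
    exact Real.rpow_le_rpow (by linarith) (by linarith) hβ.le
  have h4 : (s / 2) ^ (β - 1) = 2 ^ (1 - β) * s ^ (β - 1) := by
    rw [Real.div_rpow hs0.le (by norm_num), show 1 - β = -(β - 1) by ring,
      Real.rpow_neg (by norm_num)]
    field_simp
  have h5 : s ^ (β - 2) = s ^ (β - 1) / s := by
    rw [← Real.rpow_sub_one hs0.ne']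
    congr 1
    ring
  rw [abs_sub_comm, abs_of_nonneg (by linarith), h5, mul_div_assoc', ← h4, le_div_iff₀ hs0]
  linarith

lemma integrable_fracKernelDiff_one {β : ℝ} (hβ : 0 < β) (hβ1 : β < 1) :
    Integrable (fracKernelDiff β 1) := by
  have h1 := (integral_fracKernel_mul one_pos hβ 3 0).1
  have h2 := (integral_fracKernel_mul one_pos hβ 3 1).1
  -- The tail majorant starts at 2 so that it covers the endpoint s = 3, where the cutoff
  -- `fracKernel 1 (3 - s)` is already 0.
  have h3 : Integrable ((Ioi (2 : ℝ)).indicator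
      fun s => 2 ^ (1 - β) / Real.Gamma β * s ^ (β - 2)) :=
    (integrable_indicator_iff measurableSet_Ioi).2
      ((integrableOn_Ioi_rpow_of_lt (by linarith) (by norm_num)).const_mul _)
  refine ((h1.add h2).add h3).mono' (measurable_fracKernelDiff β 1).aestronglyMeasurable
    (Eventually.of_forall fun s => ?_)
  simp only [Pi.add_apply, sub_zero, Real.norm_eq_abs]
  have k1 := fracKernel_nonneg hβ s
  have k2 := fracKernel_nonneg hβ (s - 1)
  rcases lt_or_ge s 3 with h | h
  · rw [fracKernel_one, if_pos (by linarith), one_mul, one_mul]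
    have : 0 ≤ (Ioi (2 : ℝ)).indicator
        (fun s => 2 ^ (1 - β) / Real.Gamma β * s ^ (β - 2)) s := by
      refine indicator_nonneg (fun x hx => ?_) s
      have := Real.Gamma_pos_of_pos hβ
      have hx0 : 0 ≤ x := le_trans (by norm_num) (le_of_lt (mem_Ioi.1 hx))
      have := Real.rpow_nonneg hx0 (β - 2)
      positivity
    refine le_trans (abs_sub _ _) ?_
    rw [abs_of_nonneg k1, abs_of_nonneg k2]
    linarith
  · rw [fracKernel_of_nonpos (by linarith : 3 - s ≤ 0), zero_mul, zero_mul, zero_add, zero_add,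
      indicator_of_mem (show s ∈ Ioi (2 : ℝ) by simp only [mem_Ioi]; linarith)]
    exact abs_fracKernelDiff_one_le hβ hβ1 h

lemma fracKernelDiff_eq {β t : ℝ} (ht : 0 < t) (s : ℝ) :
    fracKernelDiff β t s = t ^ (β - 1) * fracKernelDiff β 1 (s / t) := by
  rw [fracKernelDiff, fracKernelDiff, mul_sub, ← fracKernel_mul ht, ← fracKernel_mul ht]
  congr 2 <;> field_simp

lemma integrable_fracKernelDiff {β t : ℝ} (hβ : 0 < β) (hβ1 : β < 1) (ht : 0 < t) :
    Integrable (fracKernelDiff β t) :=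
  (((integrable_fracKernelDiff_one hβ hβ1).comp_div ht.ne').const_mul (t ^ (β - 1))).congr
    (Eventually.of_forall fun s => (fracKernelDiff_eq ht s).symm)

lemma integral_norm_fracKernelDiff {β t : ℝ} (ht : 0 < t) :
    ∫ s, ‖fracKernelDiff β t s‖ = t ^ β * ∫ s, ‖fracKernelDiff β 1 s‖ := by
  simp only [fracKernelDiff_eq ht, norm_mul]
  rw [integral_const_mul, Measure.integral_comp_div (fun s => ‖fracKernelDiff β 1 s‖),
    abs_of_pos ht, Real.norm_of_nonneg (Real.rpow_nonneg ht.le _), smul_eq_mul, ← mul_assoc,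
    ← Real.rpow_add_one ht.ne', sub_add_cancel]

/-- Convolution with an integrable kernel commutes with integration. -/
lemma integral_mul_fracConv_one {m v : ℝ → ℝ} (hm : Integrable m) (hv : Integrable v) (x : ℝ) :
    Integrable (fun s => m (x - s) * fracConv 1 v s) ∧
      ∫ s, m (x - s) * fracConv 1 v s = fracConv 1 (fun r => ∫ y, v y * m (r - y)) x := by
  have hk : ∀ t, ‖fracKernel 1 t‖ ≤ 1 := fun t => by
    rw [fracKernel_one]; split_ifs <;> simp
  have h1 : Integrable (fun z : ℝ × ℝ => fracKernel 1 (z.1 - z.2) * (m (x - z.1) * v z.2))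
      (volume.prod volume) :=
    ((hm.comp_sub_left x).mul_prod hv).bdd_mul
      ((measurable_fracKernel 1).comp (measurable_fst.sub measurable_snd)).aestronglyMeasurable
      (Eventually.of_forall fun z => hk _)
  have h2 : Integrable (fun z : ℝ × ℝ => fracKernel 1 (x - z.1) * (v z.2 * m (z.1 - z.2)))
      (volume.prod volume) :=
    (hv.convolution_integrand (ContinuousLinearMap.mul ℝ ℝ) hm).bdd_mul
      ((measurable_fracKernel 1).comp (measurable_const.sub measurable_fst)).aestronglyMeasurable
      (Eventually.of_forall fun z => hk _)
  have e1 : ∀ s, ∫ y, fracKernel 1 (s - y) * (m (x - s) * v y) =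
      m (x - s) * fracConv 1 v s := fun s => by
    rw [fracConv, ← integral_const_mul]
    exact integral_congr_ae (Eventually.of_forall fun y => by simp only; ring)
  refine ⟨by simpa only [e1] using h1.integral_prod_left, ?_⟩
  have s1 := integral_integral_swap
    (f := fun s y => fracKernel 1 (s - y) * (m (x - s) * v y)) h1
  have s2 := integral_integral_swap
    (f := fun r y => fracKernel 1 (x - r) * (v y * m (r - y))) h2
  simp only [e1] at s1
  rw [fracConv]
  simp only [integral_const_mul] at s2
  rw [s1, s2]
  refine integral_congr_ae (Eventually.of_forall fun y => ?_)
  simp only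
  -- The reflection r ↦ x + y - r interchanges the two kernels.
  rw [← integral_sub_left_eq_self _ volume (x + y)]
  refine integral_congr_ae (Eventually.of_forall fun r => ?_)
  simp only
  rw [show x + y - r - y = x - r by ring, show x - (x + y - r) = r - y by ring]
  ring

lemma integral_norm_convolution_le {m v : ℝ → ℝ} (hm : Integrable m) (hv : Integrable v) :
    Integrable (fun r => ∫ y, v y * m (r - y)) ∧
      ∫ r, ‖∫ y, v y * m (r - y)‖ ≤ (∫ y, ‖v y‖) * ∫ s, ‖m s‖ := by
  have h2 : Integrable (fun z : ℝ × ℝ => v z.2 * m (z.1 - z.2)) (volume.prod volume) :=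
    hv.convolution_integrand (ContinuousLinearMap.mul ℝ ℝ) hm
  refine ⟨h2.integral_prod_left, ?_⟩
  calc ∫ r, ‖∫ y, v y * m (r - y)‖ ≤ ∫ r, ∫ y, ‖v y * m (r - y)‖ :=
        integral_mono h2.integral_prod_left.norm h2.norm.integral_prod_left
          fun r => norm_integral_le_integral_norm _
    _ = ∫ y, ∫ r, ‖v y * m (r - y)‖ :=
        integral_integral_swap (f := fun r y => ‖v y * m (r - y)‖) h2.norm
    _ = (∫ y, ‖v y‖) * ∫ s, ‖m s‖ := by
        rw [← integral_mul_const]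
        refine integral_congr_ae (Eventually.of_forall fun y => ?_)
        simp only [norm_mul]
        rw [integral_const_mul, integral_sub_right_eq_self (fun s => ‖m s‖)]

lemma integrable_fracKernel_one_mul {f : ℝ → ℝ} (hf : Integrable f) (x : ℝ) :
    Integrable fun y => fracKernel 1 (x - y) * f y :=
  hf.bdd_mul (c := 1) ((measurable_fracKernel 1).comp
    (measurable_const.sub measurable_id)).aestronglyMeasurable
    (Eventually.of_forall fun y => by
      rw [fracKernel_one]; split_ifs <;> simp)

lemma fracConv_comp_sub_right (σ : ℝ) (f : ℝ → ℝ) (t x : ℝ) :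
    fracConv σ (fun y => f (y - t)) x = fracConv σ f (x - t) := by
  rw [fracConv, fracConv,
    ← integral_sub_right_eq_self (fun y => fracKernel σ (x - t - y) * f y) t]
  refine integral_congr_ae (Eventually.of_forall fun y => ?_)
  simp only
  rw [show x - t - (y - t) = x - y by ring]

/-- The modulus of continuity in `L¹` of a function with an integrable weak derivative of
order `β`. -/
lemma integral_norm_sub_le {β C t : ℝ} (hβ : 0 < β) (hβ1 : β < 1) (ht : 0 < t) {u v : ℝ → ℝ}
    (hu : Integrable u) (hv : Integrable v)
    (hF : ∀ᵐ x, fracConv (1 - β) u x = C + fracConv 1 v x) :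
    ∫ x, ‖u x - u (x - t)‖ ≤
      t ^ β * ((∫ y, ‖v y‖) * ∫ s, ‖fracKernelDiff β 1 s‖) := by
  have hm := integrable_fracKernelDiff hβ hβ1 ht
  obtain ⟨hg, hgle⟩ := integral_norm_convolution_le hm hv
  have hut : Integrable fun x => u (x - t) := hu.comp_sub_right t
  -- Writing I^1 u = I^β I^(1-β)u and inserting `hF` turns the difference in x into one of kernels.
  -- The term with C does not depend on x, so uniqueness of primitives discards it and its value is
  -- not needed.
  have key : ∀ x, fracConv 1 (fun x => u x - u (x - t)) x =
      C * (∫ s, fracKernelDiff β t s) +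
        fracConv 1 (fun r => ∫ y, v y * fracKernelDiff β t (r - y)) x := by
    intro x
    obtain ⟨i1, i2⟩ := integral_mul_fracConv_one hm hv x
    have semi : ∀ z, Integrable (fun s => fracKernel β (z - s) * fracConv (1 - β) u s) ∧
        fracConv β (fracConv (1 - β) u) z = fracConv 1 u z := fun z => by
      have := fracConv_fracConv (σ := β) (τ := 1 - β) (x := z) hβ (by linarith)
        hu.aestronglyMeasurable (by
          rw [add_sub_cancel]
          exact integrable_fracKernel_one_mul hu z)
      rwa [add_sub_cancel] at this
    have e1 : fracConv 1 (fun x => u x - u (x - t)) x = fracConv 1 u x - fracConv 1 u (x - t) := by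
      rw [← fracConv_comp_sub_right, fracConv, fracConv, fracConv,
        ← integral_sub (integrable_fracKernel_one_mul hu x) (integrable_fracKernel_one_mul hut x)]
      simp only [mul_sub]
    rw [e1, ← (semi x).2, ← (semi (x - t)).2, fracConv, fracConv,
      ← integral_sub (semi x).1 (semi (x - t)).1, ← i2, ← integral_const_mul,
      ← integral_sub_left_eq_self (fun s => C * fracKernelDiff β t s) volume x,
      ← integral_add ((hm.const_mul C).comp_sub_left x) i1]
    refine integral_congr_ae ?_
    filter_upwards [hF] with s hs
    rw [hs, fracKernelDiff, show x - t - s = x - s - t by ring]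
    ring
  have hae := ae_eq_of_fracConv_one_eq_const_add (hu.sub hut) hg isOpen_univ
    (Eventually.of_forall fun x _ => key x)
  calc ∫ x, ‖u x - u (x - t)‖ = ∫ r, ‖∫ y, v y * fracKernelDiff β t (r - y)‖ :=
        integral_congr_ae (hae.mono fun x hx => by
          have := hx (mem_univ x)
          simp only [Pi.sub_apply] at this
          simp only [this])
    _ ≤ _ := hgle
    _ = _ := by rw [integral_norm_fracKernelDiff ht]; ring

/-! ### The Marchaud derivative -/

/-- The hypersingular kernel `t₊^(-1 - α)` of the Marchaud derivative. -/
noncomputable def marchaudKernel (α t : ℝ) : ℝ := if 0 < t then t ^ (-1 - α) else 0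

lemma measurable_marchaudKernel (α : ℝ) : Measurable (marchaudKernel α) :=
  Measurable.ite measurableSet_Ioi (measurable_id.pow_const _) measurable_const

lemma marchaudKernel_nonneg (α t : ℝ) : 0 ≤ marchaudKernel α t := by
  unfold marchaudKernel
  split_ifs with h
  · exact Real.rpow_nonneg h.le _
  · exact le_rfl

/-- A nonnegative function that is `O(t^γ)` at the origin with `γ > α > 0` and bounded is
integrable against the Marchaud kernel. -/
lemma integrable_marchaudKernel_mul {α γ A B : ℝ} (hα : 0 < α) (hαγ : α < γ) {N : ℝ → ℝ}
    (hN : AEStronglyMeasurable N) (h0 : ∀ t, 0 ≤ N t) (hA : ∀ t, 0 < t → N t ≤ A * t ^ γ)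
    (hB : ∀ t, N t ≤ B) : Integrable fun t => marchaudKernel α t * N t := by
  -- Near 0 the exponent γ - 1 - α exceeds -1; at infinity -1 - α is below -1. The two ranges
  -- overlap so that t = 1 is covered.
  have h1 : Integrable ((Ioo (0 : ℝ) 1).indicator fun t => A * t ^ (γ - 1 - α)) :=
    (integrable_indicator_iff measurableSet_Ioo).2
      (((intervalIntegral.integrableOn_Ioo_rpow_iff one_pos).2 (by linarith)).const_mul A)
  have h2 : Integrable ((Ioi (1 / 2 : ℝ)).indicator fun t => B * t ^ (-1 - α)) :=
    (integrable_indicator_iff measurableSet_Ioi).2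
      ((integrableOn_Ioi_rpow_of_lt (by linarith) (by norm_num)).const_mul B)
  refine (h1.norm.add h2.norm).mono'
    ((measurable_marchaudKernel α).aestronglyMeasurable.mul hN)
    (Eventually.of_forall fun t => ?_)
  simp only [Pi.add_apply]
  rw [Real.norm_of_nonneg (mul_nonneg (marchaudKernel_nonneg α t) (h0 t))]
  have p1 := norm_nonneg ((Ioo (0 : ℝ) 1).indicator (fun t => A * t ^ (γ - 1 - α)) t)
  have p2 := norm_nonneg ((Ioi (1 / 2 : ℝ)).indicator (fun t => B * t ^ (-1 - α)) t)
  rcases le_or_gt t 0 with ht | ht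
  · rw [marchaudKernel, if_neg ht.not_gt, zero_mul]
    linarith
  · have hp := Real.rpow_nonneg ht.le (-1 - α)
    rcases lt_or_ge t 1 with ht1 | ht1
    · refine le_trans ?_ (le_add_of_nonneg_right p2)
      rw [indicator_of_mem (show t ∈ Ioo (0 : ℝ) 1 from ⟨ht, ht1⟩), marchaudKernel, if_pos ht]
      refine le_trans ?_ (le_abs_self _)
      rw [show γ - 1 - α = (-1 - α) + γ by ring, Real.rpow_add ht]
      calc t ^ (-1 - α) * N t ≤ t ^ (-1 - α) * (A * t ^ γ) := by gcongr; exact hA t ht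
        _ = _ := by ring
    · refine le_trans ?_ (le_add_of_nonneg_left p1)
      rw [indicator_of_mem (show t ∈ Ioi (1 / 2 : ℝ) by simp only [mem_Ioi]; linarith),
        marchaudKernel, if_pos ht]
      refine le_trans ?_ (le_abs_self _)
      rw [mul_comm]
      gcongr
      exact hB t

/-- For fixed t the L¹ norm in x is at most A t^β and at most 2‖u‖₁, which is what integrability
against t^(-1-α) requires. -/
lemma integrable_marchaud_prod {α β A : ℝ} (hα : 0 < α) (hαβ : α < β) {u : ℝ → ℝ}
    (hu : Integrable u) (hA : ∀ t, 0 < t → ∫ x, ‖u x - u (x - t)‖ ≤ A * t ^ β) :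
    Integrable (fun z : ℝ × ℝ => marchaudKernel α z.2 * (u z.1 - u (z.1 - z.2)))
      (volume.prod volume) := by
  have hd : AEStronglyMeasurable (fun z : ℝ × ℝ => u z.1 - u (z.1 - z.2))
      (volume.prod volume) :=
    hu.aestronglyMeasurable.comp_fst.sub (hu.aestronglyMeasurable.comp_quasiMeasurePreserving
      (quasiMeasurePreserving_sub volume volume))
  have hi : ∀ t, Integrable fun x => u x - u (x - t) := fun t => hu.sub (hu.comp_sub_right t)
  have hm : AEStronglyMeasurable
      (fun z : ℝ × ℝ => marchaudKernel α z.2 * (u z.1 - u (z.1 - z.2))) (volume.prod volume) :=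
    ((measurable_marchaudKernel α).comp measurable_snd).aestronglyMeasurable.mul hd
  rw [integrable_prod_iff' hm]
  refine ⟨Eventually.of_forall fun t => (hi t).const_mul (marchaudKernel α t), ?_⟩
  simp only [norm_mul, Real.norm_of_nonneg (marchaudKernel_nonneg α _), integral_const_mul]
  refine integrable_marchaudKernel_mul (A := A) (B := 2 * ∫ x, ‖u x‖) hα hαβ
    hd.norm.prod_swap.integral_prod_right' (fun t => integral_nonneg fun x => norm_nonneg _) hA
    fun t => ?_
  calc ∫ x, ‖u x - u (x - t)‖ ≤ ∫ x, (‖u x‖ + ‖u (x - t)‖) :=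
        integral_mono (hi t).norm (hu.norm.add (hu.comp_sub_right t).norm)
          fun x => norm_sub_le _ _
    _ = 2 * ∫ x, ‖u x‖ := by
        rw [integral_add hu.norm (hu.comp_sub_right t).norm,
          integral_sub_right_eq_self (fun x => ‖u x‖)]
        ring

lemma IsTestFunction.exists_marchaud_bounds {Ω : Set ℝ} {φ : ℝ → ℝ} (h : IsTestFunction Ω φ) :
    ∃ L B, (∀ x t, 0 < t → |φ x - φ (x + t)| ≤ L * t ^ (1 : ℝ)) ∧
      ∀ x t, |φ x - φ (x + t)| ≤ B := by
  obtain ⟨L, hL⟩ := h.exists_bound_deriv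
  obtain ⟨B, hB⟩ := h.smooth.continuous.bounded_above_of_compact_support h.compact
  refine ⟨L, B + B, fun x t ht => ?_, fun x t => (abs_sub _ _).trans (add_le_add (hB _) (hB _))⟩
  have := Convex.norm_image_sub_le_of_norm_deriv_le (f := φ) (s := univ) (x := x + t) (y := x)
    (fun z _ => h.contDiff_one.differentiable one_ne_zero z) (fun z _ => hL z) convex_univ
    (mem_univ _) (mem_univ _)
  rw [Real.rpow_one]
  simpa [abs_of_pos ht] using this

/-- The Marchaud form of the right fractional derivative of a test function. -/
lemma IsTestFunction.integral_marchaud {Ω : Set ℝ} {φ : ℝ → ℝ} (h : IsTestFunction Ω φ)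
    {α : ℝ} (hα : 0 < α) (hα1 : α < 1) (x : ℝ) :
    ∫ t, marchaudKernel α t * (φ x - φ (x + t)) =
      Real.Gamma (1 - α) / α * rightFracDeriv α φ x := by
  have hG := Real.Gamma_pos_of_pos (by linarith : 0 < 1 - α)
  obtain ⟨L, B, hL, hB⟩ := h.exists_marchaud_bounds
  have hcont := h.smooth.continuous
  have hint : Integrable fun t => marchaudKernel α t * (φ x - φ (x + t)) := by
    have := integrable_marchaudKernel_mul (N := fun t => |φ x - φ (x + t)|) hα hα1
      (by fun_prop) (fun t => abs_nonneg _) (hL x) (hB x)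
    refine this.mono ((measurable_marchaudKernel α).aestronglyMeasurable.mul (by fun_prop))
      (Eventually.of_forall fun t => by simp)
  have hint' : Integrable fun t => fracKernel (1 - α) t * deriv φ (x + t) := by
    have := (locallyIntegrable_fracKernel (by linarith : 0 < 1 - α)
      ).integrable_smul_left_of_hasCompactSupport (g := fun t => deriv φ (x + t))
      ((h.contDiff_one.continuous_deriv le_rfl).comp (continuous_const.add continuous_id))
      (h.compact.deriv.comp_homeomorph (Homeomorph.addLeft x))
    simpa only [smul_eq_mul, mul_comm] using this
  have eJ : rightFracDeriv α φ x = - ∫ t, fracKernel (1 - α) t * deriv φ (x + t) := by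
    rw [rightFracDeriv_eq hα1 h.contDiff_one h.compact, fracCoconv,
      ← integral_add_left_eq_self _ x]
    simp only [add_sub_cancel_left]
  have e1 : ∫ t, marchaudKernel α t * (φ x - φ (x + t)) =
      ∫ t in Ioi 0, t ^ (-1 - α) * (φ x - φ (x + t)) := by
    rw [← integral_indicator measurableSet_Ioi]
    refine integral_congr_ae (Eventually.of_forall fun t => ?_)
    by_cases ht : 0 < t <;> simp [ht, marchaudKernel]
  have e2 : ∫ t, fracKernel (1 - α) t * deriv φ (x + t) =
      ∫ t in Ioi 0, t ^ (-α) / Real.Gamma (1 - α) * deriv φ (x + t) := by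
    rw [← integral_indicator measurableSet_Ioi]
    refine integral_congr_ae (Eventually.of_forall fun t => ?_)
    by_cases ht : 0 < t <;> simp [ht, fracKernel]
  have i1 : IntegrableOn (fun t => t ^ (-1 - α) * (φ x - φ (x + t))) (Ioi 0) :=
    hint.integrableOn.congr_fun (fun t ht => by simp [marchaudKernel, mem_Ioi.1 ht])
      measurableSet_Ioi
  have i2 : IntegrableOn (fun t => t ^ (-α) / Real.Gamma (1 - α) * deriv φ (x + t)) (Ioi 0) :=
    hint'.integrableOn.congr_fun (fun t ht => by simp [fracKernel, mem_Ioi.1 ht])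
      measurableSet_Ioi
  have hu : ∀ t ∈ Ioi (0 : ℝ), HasDerivAt (fun t : ℝ => t ^ (-α)) (-α * t ^ (-α - 1)) t :=
    fun t ht => Real.hasDerivAt_rpow_const (Or.inl (ne_of_gt ht))
  have hv : ∀ t ∈ Ioi (0 : ℝ), HasDerivAt (fun t => φ x - φ (x + t)) (-deriv φ (x + t)) t :=
    fun t _ => by
      have := ((h.contDiff_one.differentiable one_ne_zero (x + t)).hasDerivAt).comp_const_add x t
      simpa using this.const_sub (φ x)
  have lim0 : Tendsto (fun t : ℝ => t ^ (1 - α) * |L|) (𝓝[>] 0) (𝓝 0) := by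
    have : Tendsto (fun t : ℝ => t ^ (1 - α)) (𝓝 0) (𝓝 0) := by
      have := (Real.continuousAt_rpow_const 0 (1 - α) (Or.inr (by linarith))).tendsto
      rwa [Real.zero_rpow (by linarith)] at this
    simpa using (this.mono_left nhdsWithin_le_nhds).mul_const |L|
  -- Integration by parts of t^(-α) against φ(x) - φ(x+t). The boundary term is O(t^(1-α)) at 0 by
  -- the Lipschitz bound and O(t^(-α)) at infinity by boundedness.
  have ibp := integral_Ioi_mul_deriv_eq_deriv_mul (a := 0) (a' := 0) (b' := 0) hu hv
    (by
      refine IntegrableOn.congr_fun (i2.const_mul (-Real.Gamma (1 - α))) (fun t ht => ?_) measurableSet_Ioi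
      simp only [Pi.mul_apply]
      field_simp)
    (by
      refine IntegrableOn.congr_fun (i1.const_mul (-α)) (fun t ht => ?_) measurableSet_Ioi
      simp only [Pi.mul_apply]
      rw [show -α - 1 = -1 - α by ring, mul_assoc])
    (by
      refine squeeze_zero_norm' ?_ lim0
      filter_upwards [self_mem_nhdsWithin] with t ht
      have ht0 : (0 : ℝ) < t := ht
      have hb := hL x t ht0
      rw [Real.rpow_one] at hb
      rw [Pi.mul_apply, norm_mul, Real.norm_of_nonneg (Real.rpow_nonneg ht0.le _),
        show 1 - α = -α + 1 by ring, Real.rpow_add_one ht0.ne', mul_assoc]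
      refine mul_le_mul_of_nonneg_left ?_ (Real.rpow_nonneg ht0.le _)
      rw [mul_comm]
      exact hb.trans (mul_le_mul_of_nonneg_right (le_abs_self L) ht0.le))
    (by
      have hB' : Tendsto (fun t : ℝ => t ^ (-α) * B) atTop (𝓝 0) := by
        simpa using (tendsto_rpow_neg_atTop hα).mul_const B
      refine squeeze_zero_norm' ?_ hB'
      filter_upwards [eventually_gt_atTop 0] with t ht0
      rw [Pi.mul_apply, norm_mul, Real.norm_of_nonneg (Real.rpow_nonneg ht0.le _)]
      exact mul_le_mul_of_nonneg_left (hB x t) (Real.rpow_nonneg ht0.le _))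
  rw [eJ, e1, e2]
  have e3 : ∫ t in Ioi 0, t ^ (-α) / Real.Gamma (1 - α) * deriv φ (x + t) =
      - (1 / Real.Gamma (1 - α)) * ∫ t in Ioi 0, t ^ (-α) * -deriv φ (x + t) := by
    rw [← integral_const_mul]
    refine integral_congr_ae (Eventually.of_forall fun t => ?_)
    simp only
    ring
  have e4 : ∫ t in Ioi 0, -α * t ^ (-α - 1) * (φ x - φ (x + t)) =
      -α * ∫ t in Ioi 0, t ^ (-1 - α) * (φ x - φ (x + t)) := by
    rw [← integral_const_mul]
    refine integral_congr_ae (Eventually.of_forall fun t => ?_)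
    simp only
    rw [show -α - 1 = -1 - α by ring, mul_assoc]
  rw [e3, ibp, e4]
  field_simp
  ring

theorem IsLeftWeakFracDeriv.of_lt_univ {α β : ℝ} (hα : 0 < α) (hαβ : α < β) (hβ : β < 1)
    {u v : ℝ → ℝ} (h : IsLeftWeakFracDeriv univ β u v) (hv : Integrable v) :
    ∃ w : ℝ → ℝ, Integrable w ∧ IsLeftWeakFracDeriv univ α u w := by
  have hu : Integrable u := integrableOn_univ.1 h.integrableOn
  obtain ⟨C, hC⟩ := h.exists_fracConv_eq isOpen_univ ordConnected_univ univ_nonempty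
    (by linarith) hβ hv.integrableOn
  simp only [indicator_univ, mem_univ, forall_true_left] at hC
  have hG := Real.Gamma_pos_of_pos (by linarith : 0 < 1 - α)
  have hI := integrable_marchaud_prod (A := (∫ y, ‖v y‖) * ∫ s, ‖fracKernelDiff β 1 s‖) hα hαβ hu
    fun t ht => (integral_norm_sub_le (by linarith) hβ ht hu hv hC).trans_eq (mul_comm _ _)
  set w : ℝ → ℝ := fun x => ∫ t, marchaudKernel α t * (u x - u (x - t)) with hw
  have hwi : Integrable w := hI.integral_prod_left
  refine ⟨fun x => α / Real.Gamma (1 - α) * w x, hwi.const_mul _, h.integrableOn,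
    (hwi.const_mul _).locallyIntegrable.locallyIntegrableOn _, fun φ hφ => ?_⟩
  obtain ⟨L, B, hL, hB⟩ := hφ.exists_marchaud_bounds
  obtain ⟨M, hM⟩ := hφ.smooth.continuous.bounded_above_of_compact_support hφ.compact
  have hcont := hφ.smooth.continuous
  have hIφ : Integrable (fun z : ℝ × ℝ => φ z.1 * (marchaudKernel α z.2 *
      (u z.1 - u (z.1 - z.2)))) (volume.prod volume) :=
    hI.bdd_mul (c := M) (by fun_prop) (Eventually.of_forall fun z => hM z.1)
  have hJφ : Integrable (fun z : ℝ × ℝ => u z.1 * (marchaudKernel α z.2 *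
      (φ z.1 - φ (z.1 + z.2)))) (volume.prod volume) := by
    -- The minimum of the Lipschitz and sup bounds is uniform in x, so |u(x)| times this function of
    -- t is a product majorant.
    have hq : Integrable fun t => marchaudKernel α t * min (|L| * |t|) |B| :=
      integrable_marchaudKernel_mul (γ := 1) (A := |L|) (B := |B|) hα (hαβ.trans hβ)
        (by fun_prop) (fun t => by positivity)
        (fun t ht => by rw [Real.rpow_one, abs_of_pos ht]; exact min_le_left _ _)
        fun t => min_le_right _ _
    refine (hu.norm.mul_prod hq).mono' ?_ (Eventually.of_forall fun z => ?_)
    · refine hu.aestronglyMeasurable.comp_fst.mul (AEStronglyMeasurable.mul ?_ (by fun_prop))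
      exact ((measurable_marchaudKernel α).comp measurable_snd).aestronglyMeasurable
    · rw [norm_mul, norm_mul, Real.norm_of_nonneg (marchaudKernel_nonneg α _)]
      refine mul_le_mul_of_nonneg_left ?_ (norm_nonneg _)
      rcases le_or_gt z.2 0 with ht | ht
      · simp [marchaudKernel, ht.not_gt]
      · refine mul_le_mul_of_nonneg_left (le_min ?_ ((hB _ _).trans (le_abs_self B)))
          (marchaudKernel_nonneg α _)
        have hb := hL z.1 z.2 ht
        rw [Real.rpow_one] at hb
        exact hb.trans (mul_le_mul (le_abs_self L) (le_abs_self _) ht.le (abs_nonneg L))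
  -- Summation by parts at fixed t: translation invariance moves the backward difference of u to a
  -- forward difference of φ.
  have e1 : ∀ t, ∫ x, φ x * (marchaudKernel α t * (u x - u (x - t))) =
      ∫ x, u x * (marchaudKernel α t * (φ x - φ (x + t))) := by
    intro t
    have j1 : Integrable fun x => φ x * (marchaudKernel α t * u x) :=
      (hu.const_mul _).bdd_mul (c := M) (by fun_prop) (Eventually.of_forall fun z => hM z)
    have j2 : Integrable fun x => φ x * (marchaudKernel α t * u (x - t)) :=
      ((hu.comp_sub_right t).const_mul _).bdd_mul (c := M) (by fun_prop)
        (Eventually.of_forall fun z => hM z)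
    have j3 : Integrable fun x => φ (x + t) * (marchaudKernel α t * u x) :=
      (hu.const_mul _).bdd_mul (c := M) (by fun_prop) (Eventually.of_forall fun z => hM _)
    have k1 : ∀ x, φ x * (marchaudKernel α t * (u x - u (x - t))) =
      φ x * (marchaudKernel α t * u x) - φ x * (marchaudKernel α t * u (x - t)) :=
        fun x => by ring
    have k2 : ∀ x, u x * (marchaudKernel α t * (φ x - φ (x + t))) =
      φ x * (marchaudKernel α t * u x) - φ (x + t) * (marchaudKernel α t * u x) :=
        fun x => by ring
    simp only [k1, k2]
    rw [integral_sub j1 j2, integral_sub j1 j3,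
      ← integral_sub_right_eq_self (fun x => φ (x + t) * (marchaudKernel α t * u x)) t]
    simp only [sub_add_cancel]
  have s1 := integral_integral_swap
    (f := fun x t => φ x * (marchaudKernel α t * (u x - u (x - t)))) hIφ
  have s2 := integral_integral_swap
    (f := fun x t => u x * (marchaudKernel α t * (φ x - φ (x + t)))) hJφ
  simp only [e1] at s1
  rw [← s2] at s1
  simp only [integral_const_mul, hφ.integral_marchaud hα (hαβ.trans hβ)] at s1
  simp only [setIntegral_univ]
  have e5 : ∫ x, α / Real.Gamma (1 - α) * w x * φ x =
      α / Real.Gamma (1 - α) * ∫ x, φ x * w x := by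
    rw [← integral_const_mul]
    exact integral_congr_ae (Eventually.of_forall fun x => by simp only; ring)
  have e6 : ∫ x, u x * (Real.Gamma (1 - α) / α * rightFracDeriv α φ x) =
      Real.Gamma (1 - α) / α * ∫ x, u x * rightFracDeriv α φ x := by
    rw [← integral_const_mul]
    exact integral_congr_ae (Eventually.of_forall fun x => by simp only; ring)
  rw [e5, hw, s1, e6]
  field_simp

/-! ### Reflection and the right-sided statements -/

lemma leftFracInt_comp_neg (Ω : Set ℝ) (σ : ℝ) (f : ℝ → ℝ) (x : ℝ) :
    leftFracInt (-Ω) σ (fun y => f (-y)) x = rightFracInt Ω σ f (-x) := by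
  have e : -Ω ∩ Iio x = Neg.neg ⁻¹' (Ω ∩ Ioi (-x)) := by
    ext y
    simp
  rw [leftFracInt, rightFracInt, e]
  congr 1
  have := (Measure.measurePreserving_neg (volume : Measure ℝ)).setIntegral_preimage_emb
    (MeasurableEquiv.neg ℝ).measurableEmbedding (fun y => f y / (y - -x) ^ (1 - σ)) (Ω ∩ Ioi (-x))
  rw [← this]
  simp only [neg_sub_neg]

lemma rightFracInt_comp_neg (Ω : Set ℝ) (σ : ℝ) (f : ℝ → ℝ) (x : ℝ) :
    rightFracInt (-Ω) σ (fun y => f (-y)) x = leftFracInt Ω σ f (-x) := by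
  have := leftFracInt_comp_neg (-Ω) σ (fun y => f (-y)) (-x)
  simp only [neg_neg] at this
  exact this.symm

lemma rightFracDeriv_comp_neg (α : ℝ) (φ : ℝ → ℝ) (x : ℝ) :
    rightFracDeriv α (fun y => φ (-y)) x = leftFracDeriv α φ (-x) := by
  have e : rightFracInt univ (1 - α) (fun y => φ (-y)) =
      fun y => leftFracInt univ (1 - α) φ (-y) := by
    funext y
    simpa using rightFracInt_comp_neg univ (1 - α) φ y
  rw [rightFracDeriv, e, deriv_comp_neg, neg_neg, leftFracDeriv]

lemma leftFracDeriv_comp_neg (α : ℝ) (φ : ℝ → ℝ) (x : ℝ) :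
    leftFracDeriv α (fun y => φ (-y)) x = rightFracDeriv α φ (-x) := by
  have := rightFracDeriv_comp_neg α (fun y => φ (-y)) (-x)
  simp only [neg_neg] at this
  exact this.symm

lemma IsTestFunction.comp_neg {Ω : Set ℝ} {φ : ℝ → ℝ} (h : IsTestFunction Ω φ) :
    IsTestFunction (-Ω) fun y => φ (-y) := by
  refine ⟨h.smooth.comp contDiff_neg, h.compact.comp_homeomorph (Homeomorph.neg ℝ), fun x hx => ?_⟩
  exact h.support (tsupport_comp_subset_preimage φ continuous_neg hx)

lemma setIntegral_neg_comp_neg (Ω : Set ℝ) (f : ℝ → ℝ) :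
    ∫ x in -Ω, f (-x) = ∫ x in Ω, f x :=
  (Measure.measurePreserving_neg (volume : Measure ℝ)).setIntegral_preimage_emb
    (MeasurableEquiv.neg ℝ).measurableEmbedding f Ω

lemma integrableOn_neg_comp_neg {Ω : Set ℝ} {f : ℝ → ℝ} :
    IntegrableOn (fun x => f (-x)) (-Ω) ↔ IntegrableOn f Ω :=
  (Measure.measurePreserving_neg (volume : Measure ℝ)).integrableOn_comp_preimage
    (MeasurableEquiv.neg ℝ).measurableEmbedding

lemma LocallyIntegrableOn.comp_neg {Ω : Set ℝ} {f : ℝ → ℝ} (hf : LocallyIntegrableOn f Ω) :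
    LocallyIntegrableOn (fun x => f (-x)) (-Ω) := by
  intro x hx
  obtain ⟨s, hs, hfs⟩ := hf (-x) hx
  refine ⟨-s, ?_, integrableOn_neg_comp_neg.2 hfs⟩
  exact (continuous_neg.continuousWithinAt (s := -Ω) (x := x)).tendsto_nhdsWithin
    (fun y hy => hy) hs

lemma IsRightWeakFracDeriv.comp_neg {Ω : Set ℝ} {α : ℝ} {u v : ℝ → ℝ}
    (h : IsRightWeakFracDeriv Ω α u v) :
    IsLeftWeakFracDeriv (-Ω) α (fun x => u (-x)) fun x => v (-x) := by
  refine ⟨integrableOn_neg_comp_neg.2 h.integrableOn,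
    LocallyIntegrableOn.comp_neg h.locallyIntegrableOn, fun φ hφ => ?_⟩
  have h1 := h.integral_eq (fun y => φ (-y)) (by simpa using hφ.comp_neg)
  rw [← setIntegral_neg_comp_neg, ← setIntegral_neg_comp_neg Ω] at h1
  simpa only [leftFracDeriv_comp_neg, neg_neg] using h1

lemma IsLeftWeakFracDeriv.comp_neg {Ω : Set ℝ} {α : ℝ} {u v : ℝ → ℝ}
    (h : IsLeftWeakFracDeriv Ω α u v) :
    IsRightWeakFracDeriv (-Ω) α (fun x => u (-x)) fun x => v (-x) := by
  refine ⟨integrableOn_neg_comp_neg.2 h.integrableOn,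
    LocallyIntegrableOn.comp_neg h.locallyIntegrableOn, fun φ hφ => ?_⟩
  have h1 := h.integral_eq (fun y => φ (-y)) (by simpa using hφ.comp_neg)
  rw [← setIntegral_neg_comp_neg, ← setIntegral_neg_comp_neg Ω] at h1
  simpa only [rightFracDeriv_comp_neg, neg_neg] using h1

theorem IsRightWeakFracDeriv.of_lt_Ioo {α β : ℝ} (hα : 0 < α) (hαβ : α < β) (hβ : β < 1)
    {a b : ℝ} (hab : a < b) {u v : ℝ → ℝ} (h : IsRightWeakFracDeriv (Ioo a b) β u v)
    (hv : IntegrableOn v (Ioo a b)) :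
    ∃ l c : ℝ,
      Tendsto (rightFracInt (Ioo a b) (1 - β) u) (𝓝[<] b) (𝓝 l) ∧
      c = l / Real.Gamma (β - α) ∧
      IntegrableOn
        (fun x => c * rightKernel b (β - α) x + rightFracInt (Ioo a b) (β - α) v x)
        (Ioo a b) ∧
      IsRightWeakFracDeriv (Ioo a b) α u
        (fun x => c * rightKernel b (β - α) x + rightFracInt (Ioo a b) (β - α) v x) := by
  have hneg : -Ioo a b = Ioo (-b) (-a) := neg_Ioo a b
  have h' := h.comp_neg
  have hv' := integrableOn_neg_comp_neg.2 hv
  rw [hneg] at h' hv'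
  obtain ⟨l, c, h1, h2, h3, h4⟩ := h'.of_lt_Ioo hα hαβ hβ (neg_lt_neg hab) hv'
  simp only [← hneg, leftFracInt_comp_neg] at h3 h4
  have e : (fun x => (c * leftKernel (-b) (β - α) (-x) +
      rightFracInt (Ioo a b) (β - α) v (- -x))) =
      fun x => c * rightKernel b (β - α) x + rightFracInt (Ioo a b) (β - α) v x := by
    funext x
    rw [leftKernel, rightKernel, neg_neg, show -x - -b = b - x by ring]
  refine ⟨l, c, ?_, h2, ?_, ?_⟩
  · have ht : Tendsto (fun x : ℝ => -x) (𝓝[<] b) (𝓝[>] (-b)) := tendsto_neg_nhdsLT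
    refine (h1.comp ht).congr fun x => ?_
    rw [Function.comp_apply, ← hneg, leftFracInt_comp_neg, neg_neg]
  · have := integrableOn_neg_comp_neg.2 h3
    rwa [neg_neg, e] at this
  · have := h4.comp_neg
    simp only [neg_neg (Ioo a b), e] at this
    simpa only [neg_neg] using this

theorem IsRightWeakFracDeriv.of_lt_univ {α β : ℝ} (hα : 0 < α) (hαβ : α < β) (hβ : β < 1)
    {u v : ℝ → ℝ} (h : IsRightWeakFracDeriv univ β u v) (hv : Integrable v) :
    ∃ w : ℝ → ℝ, Integrable w ∧ IsRightWeakFracDeriv univ α u w := by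
  have h' := h.comp_neg
  rw [neg_univ] at h'
  obtain ⟨w, hw, hw'⟩ := h'.of_lt_univ hα hαβ hβ hv.comp_neg
  have := hw'.comp_neg
  simp only [neg_univ, neg_neg] at this
  exact ⟨fun x => w (-x), hw.comp_neg, this⟩

theorem mainTheorem10 (α β : ℝ) (hα : 0 < α) (hαβ : α < β) (hβ : β < 1) :
    (∀ (a b : ℝ), a < b → ∀ u v : ℝ → ℝ,
      (IsLeftWeakFracDeriv (Ioo a b) β u v → IntegrableOn v (Ioo a b) →
        ∃ l c : ℝ,
          Tendsto (leftFracInt (Ioo a b) (1 - β) u) (𝓝[>] a) (𝓝 l) ∧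
          c = l / Real.Gamma (β - α) ∧
          IntegrableOn
            (fun x => c * leftKernel a (β - α) x + leftFracInt (Ioo a b) (β - α) v x)
            (Ioo a b) ∧
          IsLeftWeakFracDeriv (Ioo a b) α u
            (fun x => c * leftKernel a (β - α) x + leftFracInt (Ioo a b) (β - α) v x)) ∧
      (IsRightWeakFracDeriv (Ioo a b) β u v → IntegrableOn v (Ioo a b) →
        ∃ l c : ℝ,
          Tendsto (rightFracInt (Ioo a b) (1 - β) u) (𝓝[<] b) (𝓝 l) ∧
          c = l / Real.Gamma (β - α) ∧
          IntegrableOn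
            (fun x => c * rightKernel b (β - α) x + rightFracInt (Ioo a b) (β - α) v x)
            (Ioo a b) ∧
          IsRightWeakFracDeriv (Ioo a b) α u
            (fun x => c * rightKernel b (β - α) x + rightFracInt (Ioo a b) (β - α) v x))) ∧
    (∀ u v : ℝ → ℝ,
      (IsLeftWeakFracDeriv univ β u v → Integrable v →
        ∃ w : ℝ → ℝ, Integrable w ∧ IsLeftWeakFracDeriv univ α u w) ∧
      (IsRightWeakFracDeriv univ β u v → Integrable v →
        ∃ w : ℝ → ℝ, Integrable w ∧ IsRightWeakFracDeriv univ α u w)) := by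
  exact ⟨fun a b hab u v => ⟨fun h hv => h.of_lt_Ioo hα hαβ hβ hab hv,
      fun h hv => h.of_lt_Ioo hα hαβ hβ hab hv⟩,
    fun u v => ⟨fun h hv => h.of_lt_univ hα hαβ hβ hv, fun h hv => h.of_lt_univ hα hαβ hβ hv⟩⟩
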